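/- Let $A\in\mathbb R^{n\times n}$ be neutrally stable (no eigenvalue has modulus larger than $1$, and every Jordan block of an eigenvalue of modulus $1$ has size one) and let $C\in\mathbb R^{q\times n}$. The pair $(A,C)$ is detectable if $A+LC$ is Schur stable (all its eigenvalues have modulus less than $1$) for some $L\in\mathbb R^{n\times q}$. For a gain $L\in\mathbb R^{n\times q}$ consider the network $$x_i^+=Ax_i+LC\sum_{j=1}^N d_{ij}(x_i-x_j),\qquad i=1,\dots,N,$$ with states $x_i(k)\in\mathbb R^n$ at times $k=0,1,2,\dots$. Here $(d_{ij})$ is a row-stochastic matrix associated with a directed graph on the nodes $1,\dots,N$, whose edges are ordered pairs of distinct nodes: $d_{ii}>0$; for $j\ne i$, $d_{ij}>0$ if $(j,i)$ is an edge and $d_{ij}=0$ otherwise; and $\sum_j d_{ij}=1$. Let $\Gamma_N$ be the set of such graphs that contain a directed spanning tree (from some node there is a directed path to every other node). The network reaches consensus with respect to $\Gamma_N$ if, for every graph in $\Gamma_N$, every matrix $(d_{ij})$ associated with it and all initial states, $x_i(k)-x_j(k)\to0$ as $k\to\infty$ for all $i,j$. The consensus region of the network is $\mathcal S_L=\{\sigma\in\mathbb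 C: A+(1-\sigma)LC\text{ is Schur stable}\}$. Let $\mathbb D=\{\sigma\in\mathbb C:|\sigma|<1\}$. Then: 1. There is an $L$ with $\mathbb D\subseteq\mathcal S_L$ if and only if $(A,C)$ is detectable. If $A$ is not Schur stable, there is an $L$ with $\mathcal S_L=\mathbb D$ if and only if $(A,C)$ is detectable. 2. For every $N\ge2$, there is an $L$ for which the network reaches consensus with respect to $\Gamma_N$ if and only if $(A,C)$ is detectable. 3. For every $L$: $\mathbb D\subseteq\mathcal S_L$ if and only if the network reaches consensus with respect to $\Gamma_N$ for all $N$. 4. If $(A,C)$ is detectable, then the following construction can be carried out, and every $L$ that it yields satisfies $\mathbb D\subseteq\mathcal S_L$ (with equality if $A$ is not Schur stable) and makes the network reach consensus with respect to $\Gamma_N$ for all $N$. Choose real matrices $U,W$ such that $[U\ W]$ is invertible and $[U\ W]^{-1}A[U\ W]=\begin{bmatrix}M&0\\0&X\end{bmatrix}$ with $M$ orthogonal and $X$ Schur stable. Choose a real $V$ with $VV^T=I$ and $\operatorname{range}(V^T)=\operatorname{range}(U^TC^T)$. Put $L=-UMV^TS$, where $S$ is a left inverse of $CUV^T$, so that $S=(CUV^T)^{-1}$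 if $CU$ has full row rank. -/

import Mathlib

open Filter Topology

/-- A real matrix regarded as a complex one. -/
noncomputable def toComplex {m n : ℕ} (A : Matrix (Fin m) (Fin n) ℝ) :
    Matrix (Fin m) (Fin n) ℂ :=
  A.map (fun a : ℝ => (a : ℂ))

/-- Schur stability: all eigenvalues have magnitude less than one. -/
def SchurStable {n : ℕ} (A : Matrix (Fin n) (Fin n) ℂ) : Prop :=
  ∀ μ ∈ spectrum ℂ A, ‖μ‖ < 1

/-- Neutral stability in the discrete-time sense: no eigenvalue has magnitude larger than one, and
every Jordan block of an eigenvalue of unit magnitude has size one, that is, its generalized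
eigenspace is just its eigenspace. -/
def NeutrallyStable {n : ℕ} (A : Matrix (Fin n) (Fin n) ℂ) : Prop :=
  ∀ μ ∈ spectrum ℂ A, ‖μ‖ ≤ 1 ∧
    (‖μ‖ = 1 →
      Module.End.maxGenEigenspace (Matrix.toLin' A) μ = Module.End.eigenspace (Matrix.toLin' A) μ)

/-- The pair `(A, C)` is detectable (in discrete time): some real output injection makes `A + L C`
Schur stable. -/
def Detectable {n q : ℕ} (A : Matrix (Fin n) (Fin n) ℝ) (C : Matrix (Fin q) (Fin n) ℝ) : Prop :=
  ∃ L : Matrix (Fin n) (Fin q) ℝ, SchurStable (toComplex (A + L * C))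

/-- The discrete-time consensus region: all complex `σ` with `A + (1 - σ) L C` Schur stable. -/
def consensusRegion {n q : ℕ} (A : Matrix (Fin n) (Fin n) ℝ) (C : Matrix (Fin q) (Fin n) ℝ)
    (L : Matrix (Fin n) (Fin q) ℝ) : Set ℂ :=
  {σ | SchurStable (toComplex A + (1 - σ) • (toComplex L * toComplex C))}

/-- The directed graphs on `N` nodes (edges join distinct nodes; `G.Adj j i` is the edge from the
parent `j` to the child `i`) that contain a directed spanning tree: some root has a directed path
to every other node. -/
def spanningTreeGraphs (N : ℕ) : Set (Digraph (Fin N)) :=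
  {G | (∀ i, ¬ G.Adj i i) ∧ ∃ r, ∀ i, i ≠ r → Relation.TransGen G.Adj r i}

/-- `D` is a row-stochastic matrix associated with the directed graph `G`. -/
def IsStochasticMatrixOf {N : ℕ} (D : Matrix (Fin N) (Fin N) ℝ) (G : Digraph (Fin N)) : Prop :=
  (∀ i, 0 < D i i) ∧
  (∀ i j, i ≠ j → G.Adj j i → 0 < D i j) ∧
  (∀ i j, i ≠ j → ¬ G.Adj j i → D i j = 0) ∧
  (∀ i, ∑ j, D i j = 1)

/-- `x` is a trajectory of the network `x_i⁺ = A x_i + L C ∑ j, d_ij (x_i - x_j)`;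
`x k i` is the state of agent `i` at time `k`. -/
def IsNetworkTrajectory {n q N : ℕ} (A : Matrix (Fin n) (Fin n) ℝ) (C : Matrix (Fin q) (Fin n) ℝ)
    (L : Matrix (Fin n) (Fin q) ℝ) (D : Matrix (Fin N) (Fin N) ℝ)
    (x : ℕ → Fin N → Fin n → ℝ) : Prop :=
  ∀ k i, x (k + 1) i =
    A.mulVec (x k i) + (L * C).mulVec (∑ j, D i j • (x k i - x k j))

/-- The network reaches consensus: along every trajectory, all state differences tend to `0`. -/
def ReachesConsensus {n q N : ℕ} (A : Matrix (Fin n) (Fin n) ℝ) (C : Matrix (Fin q) (Fin n) ℝ)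
    (L : Matrix (Fin n) (Fin q) ℝ) (D : Matrix (Fin N) (Fin N) ℝ) : Prop :=
  ∀ x : ℕ → Fin N → Fin n → ℝ, IsNetworkTrajectory A C L D x →
    ∀ i j, Tendsto (fun k => x k i - x k j) atTop (𝓝 0)

/-- The network of `N` agents with gain `L` reaches consensus for all communication topologies on
`N` nodes that contain a directed spanning tree. -/
def ReachesConsensusForAllTopologies {n q : ℕ} (A : Matrix (Fin n) (Fin n) ℝ)
    (C : Matrix (Fin q) (Fin n) ℝ) (L : Matrix (Fin n) (Fin q) ℝ) (N : ℕ) : Prop :=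
  ∀ G ∈ spanningTreeGraphs N, ∀ D : Matrix (Fin N) (Fin N) ℝ, IsStochasticMatrixOf D G →
    ReachesConsensus A C L D

/-- `L` is a possible outcome of the construction of the gain:
* choose `U`, `W` with `[U W]⁻¹ A [U W] = diag (M, X)`, `M` orthogonal and `X` Schur stable;
* choose `V` with `V Vᵀ = I` and `range Vᵀ = range (Uᵀ Cᵀ)`;
* put `L = - U M Vᵀ (C U Vᵀ)⁻¹`.

Here `T` is the two-sided inverse of `[U W]`.  The matrix `C U Vᵀ` has full column rank; it is
square and invertible exactly if `C U` has full row rank, and then its left inverse `S` is its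
inverse.  If `C U` has redundant rows, any left inverse may be used. -/
def IsAlgorithmGain {n q : ℕ} (A : Matrix (Fin n) (Fin n) ℝ) (C : Matrix (Fin q) (Fin n) ℝ)
    (L : Matrix (Fin n) (Fin q) ℝ) : Prop :=
  ∃ (n₁ n₂ m : ℕ) (U : Matrix (Fin n) (Fin n₁) ℝ) (W : Matrix (Fin n) (Fin n₂) ℝ)
    (T : Matrix (Fin n₁ ⊕ Fin n₂) (Fin n) ℝ)
    (M : Matrix (Fin n₁) (Fin n₁) ℝ) (X : Matrix (Fin n₂) (Fin n₂) ℝ)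
    (V : Matrix (Fin m) (Fin n₁) ℝ) (S : Matrix (Fin m) (Fin q) ℝ),
    T * Matrix.fromCols U W = 1 ∧ Matrix.fromCols U W * T = 1 ∧
    T * A * Matrix.fromCols U W = Matrix.fromBlocks M 0 0 X ∧
    M ∈ Matrix.orthogonalGroup (Fin n₁) ℝ ∧
    SchurStable (toComplex X) ∧
    V * V.transpose = 1 ∧
    LinearMap.range V.transpose.mulVecLin =
      LinearMap.range (U.transpose * C.transpose).mulVecLin ∧
    S * (C * U * V.transpose) = 1 ∧
    L = -(U * M * V.transpose * S)

/-! Detectability is necessary because `σ = 0` lies in the disk: there `A + (1 - σ)LC` is `A + LC`.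
For consensus with a fixed `N ≥ 2`, the matrix with all entries `1/N` has eigenvalue `0` with a
nonconstant eigenvector, and consensus forces stability at every such eigenvalue
(`ReachesConsensus.schurStable`).

If the disk lies in the consensus region, follow the combinations `∑ y i • x i` whose weights sum to
zero. The transpose of `D` acts on these weights with eigenvalues in the open disk, since some power
of `D` contracts the ℓ¹ norm there. Its generalized eigenvectors give a cascade of systems `A + (1 -
σ)LC`, each driven by a vanishing input, and `e_i - e_j` is such a weight. Conversely, every point
of the disk is a nontrivial eigenvalue of some positive stochastic matrix, whose size depends on the
point (`exists_stochastic_eigenvalue`).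

For a constructed gain, the closed loop acts on range `U` by `a ↦ M (a - (1 - σ) P a)`, with `P` the
orthogonal projection onto the row space of `CU`. Since `M` is an isometry, the squared norm changes
by exactly `-(1 - ‖σ‖²) ‖Pa‖²`. Inside the disk an unstable mode must therefore have `Pa = 0`, so it
is unobservable, against detectability; on or outside the unit circle the norm cannot decrease.

The construction exists because neutral stability bounds the powers of `A`. These accumulate at an
idempotent, whose range and kernel split the space; averaging Gram matrices on the range yields an
invariant inner product, making that block orthogonal. -/

open scoped Matrix

/-! ### Eigenvectors and generalized eigenspaces -/

theorem schurStable_iff {n : ℕ} {A : Matrix (Fin n) (Fin n) ℂ} :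
    SchurStable A ↔ ∀ (μ : ℂ) (v : Fin n → ℂ), v ≠ 0 → A.mulVec v = μ • v → ‖μ‖ < 1 := by
  have key : ∀ μ : ℂ, μ ∈ spectrum ℂ A ↔ ∃ v : Fin n → ℂ, v ≠ 0 ∧ A.mulVec v = μ • v := by
    intro μ
    rw [← Matrix.spectrum_toLin', ← Module.End.hasEigenvalue_iff_mem_spectrum]
    constructor
    · intro h
      obtain ⟨v, hv⟩ := h.exists_hasEigenvector
      exact ⟨v, hv.2, by simpa using hv.apply_eq_smul⟩
    · rintro ⟨v, hv, h⟩
      exact Module.End.hasEigenvalue_of_hasEigenvector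
        (Module.End.hasEigenvector_iff.2 ⟨Module.End.mem_eigenspace_iff.2 (by simpa using h), hv⟩)
  constructor
  · intro h μ v hv hvμ
    exact h μ ((key μ).2 ⟨v, hv, hvμ⟩)
  · intro h μ hμ
    obtain ⟨v, hv, hvμ⟩ := (key μ).1 hμ
    exact h μ v hv hvμ

theorem SchurStable.transpose {n : ℕ} {A : Matrix (Fin n) (Fin n) ℂ} (h : SchurStable A) :
    SchurStable A.transpose := by
  intro μ hμ
  refine h μ ?_
  rw [spectrum.mem_iff] at hμ ⊢
  rwa [← Matrix.isUnit_transpose, Matrix.transpose_sub, Algebra.algebraMap_eq_smul_one,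
    Matrix.transpose_smul, Matrix.transpose_one, ← Algebra.algebraMap_eq_smul_one]

/-- If `(f - σ)^k y = 0`, pulling membership back through `f - σ` leads from `0 ∈ P` to `y ∈ P`. No
invariance of `P` under `f` is needed, so `P` may be defined by the asymptotics of a sequence. -/
theorem Module.End.maxGenEigenspace_le {V : Type*} [AddCommGroup V] [Module ℂ V]
    (f : Module.End ℂ V) (P : Submodule ℂ V) (σ : ℂ)
    (h : f.HasEigenvalue σ → ∀ y, f y - σ • y ∈ P → y ∈ P) : f.maxGenEigenspace σ ≤ P := by
  intro y hy
  rw [Module.End.mem_maxGenEigenspace] at hy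
  obtain ⟨k, hk⟩ := hy
  by_cases hσ : f.HasEigenvalue σ
  · induction k generalizing y with
    | zero => simp_all
    | succ k ih =>
      refine h hσ y (ih ?_)
      rw [pow_succ] at hk
      simpa using hk
  · have : y = 0 := by
      induction k generalizing y with
      | zero => simpa using hk
      | succ k ih =>
        rw [pow_succ] at hk
        have h1 := ih hk
        by_contra hy
        refine hσ (Module.End.hasEigenvalue_of_hasEigenvector (x := y)
          (Module.End.hasEigenvector_iff.2 ⟨Module.End.mem_eigenspace_iff.2 ?_, hy⟩))
        rw [← sub_eq_zero]
        simpa using h1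
    simp [this]

theorem Module.End.eq_top_of_forall_eigenvalue {V : Type*} [AddCommGroup V] [Module ℂ V]
    [FiniteDimensional ℂ V] (f : Module.End ℂ V) (P : Submodule ℂ V)
    (h : ∀ σ, f.HasEigenvalue σ → ∀ y, f y - σ • y ∈ P → y ∈ P) : P = ⊤ := by
  rw [eq_top_iff, ← Module.End.iSup_maxGenEigenspace_eq_top f]
  exact iSup_le fun σ => Module.End.maxGenEigenspace_le f P σ (h σ)

/-! ### Stable linear recursions with vanishing input -/

theorem tendsto_zero_of_le_mul_add {u e : ℕ → ℝ} {ρ : ℝ} (hu : ∀ k, 0 ≤ u k) (hρ0 : 0 ≤ ρ)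
    (hρ : ρ < 1) (h : ∀ k, u (k + 1) ≤ ρ * u k + e k) (he : Tendsto e atTop (𝓝 0)) :
    Tendsto u atTop (𝓝 0) := by
  rw [Metric.tendsto_atTop]
  intro ε hε
  have hδ : 0 < (1 - ρ) * (ε / 2) := by
    have : 0 < 1 - ρ := by linarith
    positivity
  obtain ⟨K, hK⟩ := eventually_atTop.1 (he.eventually (gt_mem_nhds hδ))
  have hb : ∀ j, u (K + j) ≤ ρ ^ j * u K + ε / 2 := by
    intro j
    induction j with
    | zero => simp; linarith
    | succ j ih =>
      have h1 := h (K + j)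
      have h2 := hK (K + j) (by omega)
      have h3 := mul_le_mul_of_nonneg_left ih hρ0
      rw [← add_assoc, pow_succ]
      linarith
  have ht : Tendsto (fun j => ρ ^ j * u K) atTop (𝓝 0) := by
    simpa using (tendsto_pow_atTop_nhds_zero_of_lt_one hρ0 hρ).mul_const (u K)
  obtain ⟨J, hJ⟩ := eventually_atTop.1 (ht.eventually (gt_mem_nhds (half_pos hε)))
  refine ⟨K + J, fun k hk => ?_⟩
  obtain ⟨j, rfl⟩ := Nat.exists_eq_add_of_le (show K ≤ k by omega)
  rw [Real.dist_0_eq_abs, abs_of_nonneg (hu _)]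
  have := hb j
  have := hJ j (by omega)
  linarith

theorem tendsto_zero_of_eq_mul_add {w e : ℕ → ℂ} {σ : ℂ} (hσ : ‖σ‖ < 1)
    (h : ∀ k, w (k + 1) = σ * w k + e k) (he : Tendsto e atTop (𝓝 0)) :
    Tendsto w atTop (𝓝 0) := by
  rw [tendsto_zero_iff_norm_tendsto_zero] at he ⊢
  refine tendsto_zero_of_le_mul_add (fun _ => norm_nonneg _) (norm_nonneg σ) hσ (fun k => ?_) he
  rw [h k, ← norm_mul]
  exact norm_add_le _ _

/-- The solutions of a Schur stable linear recursion with vanishing input tend to zero. -/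
theorem SchurStable.tendsto_zero {n : ℕ} {B : Matrix (Fin n) (Fin n) ℂ} (hB : SchurStable B)
    {z e : ℕ → Fin n → ℂ} (h : ∀ k, z (k + 1) = B.mulVec (z k) + e k)
    (he : Tendsto e atTop (𝓝 0)) : Tendsto z atTop (𝓝 0) := by
  -- The functionals along which `z` decays. For `y` with `Bᵀ y - σ y` already in `P`, the scalar `y
  -- ⬝ᵥ z k` satisfies a recursion with factor `σ` and vanishing input.
  let P : Submodule ℂ (Fin n → ℂ) :=
    { carrier := {y | Tendsto (fun k => y ⬝ᵥ z k) atTop (𝓝 0)}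
      zero_mem' := by simp
      add_mem' := by
        intro a b ha hb
        simpa [add_dotProduct] using Tendsto.add ha hb
      smul_mem' := by
        intro c a ha
        simpa [smul_dotProduct] using Tendsto.const_mul c ha }
  have hP : P = ⊤ := by
    refine Module.End.eq_top_of_forall_eigenvalue (Matrix.toLin' B.transpose) P ?_
    intro σ hσ y hy
    rw [Module.End.hasEigenvalue_iff_mem_spectrum, Matrix.spectrum_toLin'] at hσ
    have hσ1 := hB.transpose σ hσ
    have hye : Tendsto (fun k => y ⬝ᵥ e k) atTop (𝓝 0) := by
      have : Continuous fun x : Fin n → ℂ => y ⬝ᵥ x := by fun_prop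
      simpa [Function.comp_def] using (this.tendsto 0).comp he
    have hy' : Tendsto (fun k => (B.transpose.mulVec y - σ • y) ⬝ᵥ z k) atTop (𝓝 0) := hy
    refine tendsto_zero_of_eq_mul_add (w := fun k => y ⬝ᵥ z k) hσ1 (fun k => ?_)
      (by simpa using hy'.add hye)
    rw [h k, dotProduct_add, Matrix.mulVec_transpose, Matrix.dotProduct_mulVec]
    ring
  rw [tendsto_pi_nhds]
  intro i
  have : Pi.single i (1 : ℂ) ∈ P := by rw [hP]; trivial
  have h2 : Tendsto (fun k => Pi.single i (1 : ℂ) ⬝ᵥ z k) atTop (𝓝 0) := this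
  simpa using h2

/-! ### Stochastic matrices of graphs with a spanning tree -/

theorem IsStochasticMatrixOf.nonneg {N : ℕ} {D : Matrix (Fin N) (Fin N) ℝ} {G : Digraph (Fin N)}
    (h : IsStochasticMatrixOf D G) (i j : Fin N) : 0 ≤ D i j := by
  rcases eq_or_ne i j with rfl | hij
  · exact (h.1 i).le
  · by_cases hG : G.Adj j i
    · exact (h.2.1 i j hij hG).le
    · exact (h.2.2.1 i j hij hG).ge

theorem Matrix.pow_succ_apply_pos {ι : Type*} [Fintype ι] [DecidableEq ι] {D : Matrix ι ι ℝ}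
    (h : ∀ i j, 0 ≤ D i j) {k : ℕ} {i j l : ι} (h1 : 0 < D i j) (h2 : 0 < (D ^ k) j l) :
    0 < (D ^ (k + 1)) i l := by
  rw [pow_succ', Matrix.mul_apply]
  exact Finset.sum_pos' (fun a _ => mul_nonneg (h i a) (Matrix.pow_apply_nonneg h k a l))
    ⟨j, Finset.mem_univ j, mul_pos h1 h2⟩

theorem Matrix.sum_row_pow {ι : Type*} [Fintype ι] [DecidableEq ι] {D : Matrix ι ι ℝ}
    (h : ∀ i, ∑ j, D i j = 1) (k : ℕ) (i : ι) : ∑ j, (D ^ k) i j = 1 := by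
  induction k generalizing i with
  | zero => simp [Matrix.one_apply]
  | succ k ih =>
    simp only [pow_succ', Matrix.mul_apply]
    rw [Finset.sum_comm]
    simp [← Finset.mul_sum, ih, h]

/-- Some power of a stochastic matrix of a graph with a spanning tree has a positive column. -/
theorem IsStochasticMatrixOf.exists_pow_pos {N : ℕ} {D : Matrix (Fin N) (Fin N) ℝ}
    {G : Digraph (Fin N)} (h : IsStochasticMatrixOf D G) (hG : G ∈ spanningTreeGraphs N) :
    ∃ (m : ℕ) (r : Fin N), ∀ i, 0 < (D ^ m) i r := by
  obtain ⟨-, r, hr⟩ := hG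
  have hstep : ∀ i j k, G.Adj j i → 0 < (D ^ k) j r → 0 < (D ^ (k + 1)) i r := by
    intro i j k hij hk
    refine Matrix.pow_succ_apply_pos h.nonneg ?_ hk
    rcases eq_or_ne i j with rfl | hne
    · exact h.1 i
    · exact h.2.1 i j hne hij
  have hex : ∀ i, ∃ k, 0 < (D ^ k) i r := by
    intro i
    by_cases hi : i = r
    · exact ⟨0, by simp [hi]⟩
    · have ht := hr i hi
      clear hi
      induction ht with
      | single hb => exact ⟨1, hstep _ r 0 hb (by simp)⟩
      | tail _ hb ih =>
        obtain ⟨k, hk⟩ := ih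
        exact ⟨k + 1, hstep _ _ k hb hk⟩
  have hmono : ∀ i k l, 0 < (D ^ k) i r → 0 < (D ^ (k + l)) i r := by
    intro i k l hk
    induction l with
    | zero => simpa using hk
    | succ l ih => exact Matrix.pow_succ_apply_pos h.nonneg (h.1 i) ih
  choose k hk using hex
  refine ⟨∑ i, k i, r, fun i => ?_⟩
  have := hmono i (k i) (∑ j, k j - k i) (hk i)
  rwa [Nat.add_sub_cancel' (Finset.single_le_sum (fun _ _ => Nat.zero_le _) (Finset.mem_univ i))]
    at this

/-- Subtracting the constant `ε` from column `r` does not change the product with a zero-sum row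
vector, leaves a nonnegative matrix, and lowers every row sum to `1 - ε`. -/
theorem Matrix.sum_norm_vecMul_le {ι : Type*} [Fintype ι] [DecidableEq ι] {B : Matrix ι ι ℝ}
    (h0 : ∀ i j, 0 ≤ B i j) (h1 : ∀ i, ∑ j, B i j = 1) {ε : ℝ} {r : ι} (hr : ∀ i, ε ≤ B i r)
    {y : ι → ℂ} (hy : ∑ i, y i = 0) :
    ∑ j, ‖∑ i, y i * (B i j : ℂ)‖ ≤ (1 - ε) * ∑ i, ‖y i‖ := by
  have hle : ∀ j, ‖∑ i, y i * (B i j : ℂ)‖ ≤ ∑ i, ‖y i‖ * (B i j - if j = r then ε else 0) := by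
    intro j
    have : ∑ i, y i * (B i j : ℂ) =
        ∑ i, y i * ((B i j - if j = r then ε else 0 : ℝ) : ℂ) := by
      push_cast
      simp only [mul_sub, Finset.sum_sub_distrib, ← Finset.sum_mul, hy]
      simp
    rw [this]
    refine (norm_sum_le _ _).trans (Finset.sum_le_sum fun i _ => ?_)
    rw [norm_mul, Complex.norm_real, Real.norm_eq_abs, abs_of_nonneg]
    split_ifs with hj
    · subst hj
      linarith [hr i]
    · linarith [h0 i j]
  refine (Finset.sum_le_sum fun j _ => hle j).trans (le_of_eq ?_)
  rw [Finset.sum_comm, Finset.mul_sum]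
  refine Finset.sum_congr rfl fun i _ => ?_
  rw [← Finset.mul_sum, Finset.sum_sub_distrib, h1 i]
  simp [mul_comm]

/-- The non-trivial left eigenvalues of a stochastic matrix of a graph with a spanning tree lie in
the open unit disk. -/
theorem IsStochasticMatrixOf.norm_lt_one {N : ℕ} {D : Matrix (Fin N) (Fin N) ℝ}
    {G : Digraph (Fin N)} (h : IsStochasticMatrixOf D G) (hG : G ∈ spanningTreeGraphs N)
    {σ : ℂ} {y : Fin N → ℂ} (hy0 : y ≠ 0) (hy : ∑ i, y i = 0)
    (hσ : Matrix.vecMul y (toComplex D) = σ • y) : ‖σ‖ < 1 := by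
  obtain ⟨m, r, hm⟩ := h.exists_pow_pos hG
  have : Nonempty (Fin N) := ⟨r⟩
  obtain ⟨i₀, hi₀⟩ := Finite.exists_min fun i => (D ^ m) i r
  have hpow : ∀ k, Matrix.vecMul y (toComplex D ^ k) = σ ^ k • y := by
    intro k
    induction k with
    | zero => simp
    | succ k ih => rw [pow_succ, ← Matrix.vecMul_vecMul, ih, Matrix.smul_vecMul, hσ, smul_smul,
        pow_succ]
  have hmap : toComplex D ^ m = toComplex (D ^ m) :=
    (Matrix.map_pow D Complex.ofRealHom m).symm
  -- With `ε` the least entry of the positive column, the eigenvector equation for `D ^ m` will give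
  -- `‖σ‖ ^ m ≤ 1 - ε < 1`.
  have hle := Matrix.sum_norm_vecMul_le (Matrix.pow_apply_nonneg h.nonneg m)
    (Matrix.sum_row_pow h.2.2.2 m) hi₀ hy
  have heq : ∀ j, ∑ i, y i * (((D ^ m) i j : ℝ) : ℂ) = σ ^ m * y j := by
    intro j
    have := congrFun (hpow m) j
    rw [hmap] at this
    exact this
  simp only [heq, norm_mul, norm_pow, ← Finset.mul_sum] at hle
  have hS : 0 < ∑ i, ‖y i‖ := by
    obtain ⟨i, hi⟩ := Function.ne_iff.1 hy0
    exact Finset.sum_pos' (fun _ _ => norm_nonneg _) ⟨i, Finset.mem_univ i, norm_pos_iff.2 hi⟩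
  by_contra! hge
  have h1 := le_of_mul_le_mul_right hle hS
  have h2 := one_le_pow₀ hge (n := m)
  linarith [hm i₀]

/-! ### Consensus region versus network consensus -/

theorem toComplex_mul {l m n : ℕ} (A : Matrix (Fin l) (Fin m) ℝ) (B : Matrix (Fin m) (Fin n) ℝ) :
    toComplex (A * B) = toComplex A * toComplex B :=
  Matrix.map_mul (f := Complex.ofRealHom)

/-- If the consensus region contains the open unit disk, then the network reaches consensus for
every graph that contains a spanning tree. -/
theorem reachesConsensus_of_ball_subset {n q N : ℕ} {A : Matrix (Fin n) (Fin n) ℝ}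
    {C : Matrix (Fin q) (Fin n) ℝ} {L : Matrix (Fin n) (Fin q) ℝ}
    (hL : Metric.ball (0 : ℂ) 1 ⊆ consensusRegion A C L) :
    ReachesConsensusForAllTopologies A C L N := by
  intro G hG D hD x hx i j
  let X : ℕ → Matrix (Fin N) (Fin n) ℂ := fun k => Matrix.of fun i a => (x k i a : ℂ)
  have hXa : ∀ k i a, X k i a = (x k i a : ℂ) := fun _ _ _ => rfl
  clear_value X
  have hX : ∀ k, X (k + 1) = X k * (toComplex A).transpose +
      (X k - toComplex D * X k) * (toComplex L * toComplex C).transpose := by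
    intro k
    ext i a
    have h1 := congrFun (hx k i) a
    have h2 : ∑ j, D i j • (x k i - x k j) = fun b => x k i b - ∑ j, D i j * x k j b := by
      ext b
      simp [mul_sub, ← Finset.sum_mul, hD.2.2.2 i]
    rw [h2] at h1
    simp only [hXa, ← toComplex_mul, h1]
    simp [toComplex, Matrix.mul_apply, Matrix.mulVec, dotProduct, mul_comm, hXa]
  -- Restricting to zero-sum weights removes the eigenvalue `1` of the constant vectors.
  let Y : Submodule ℂ (Fin N → ℂ) := LinearMap.ker (∑ i, LinearMap.proj (R := ℂ) (φ := fun _ => ℂ) i)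
  have hYmem : ∀ y, y ∈ Y ↔ ∑ i, y i = 0 := by
    intro y
    simp [Y, LinearMap.mem_ker]
  have hYf : ∀ y ∈ Y, Matrix.toLin' (toComplex D).transpose y ∈ Y := by
    intro y hy
    rw [hYmem] at hy ⊢
    simp only [Matrix.toLin'_apply, Matrix.mulVec_transpose, Matrix.vecMul, dotProduct]
    rw [Finset.sum_comm]
    have : ∀ i, ∑ j, toComplex D i j = 1 := fun i => by
      simp only [toComplex, Matrix.map_apply]
      exact_mod_cast hD.2.2.2 i
    simp [← Finset.mul_sum, this, hy]
  let f : Module.End ℂ Y := (Matrix.toLin' (toComplex D).transpose).restrict hYf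
  let P : Submodule ℂ Y :=
    { carrier := {y | Tendsto (fun k => Matrix.vecMul y.1 (X k)) atTop (𝓝 0)}
      zero_mem' := by simp
      add_mem' := by
        intro a b ha hb
        simpa [Matrix.add_vecMul] using Tendsto.add ha hb
      smul_mem' := by
        intro c a ha
        simpa [Matrix.smul_vecMul] using Tendsto.const_smul ha c }
  have hP : P = ⊤ := by
    refine Module.End.eq_top_of_forall_eigenvalue f P ?_
    intro σ hσ y hy
    have hσ1 : ‖σ‖ < 1 := by
      obtain ⟨v, hv⟩ := hσ.exists_hasEigenvector
      refine hD.norm_lt_one hG (y := v.1) (by simpa using hv.2) ((hYmem _).1 v.2) ?_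
      have := congrArg Subtype.val hv.apply_eq_smul
      simpa [f, Matrix.mulVec_transpose] using this
    have hB : SchurStable (toComplex A + (1 - σ) • (toComplex L * toComplex C)) :=
      hL (by simpa using hσ1)
    -- The defect `w` vanishes for an eigenvector; along a Jordan chain it contributes the input
    -- `-LC (Xᵀ w)`, which tends to zero by hypothesis.
    set w := f y - σ • y with hw
    have hw' : Matrix.vecMul y.1 (toComplex D) = σ • y.1 + w.1 := by
      simp [hw, f, Matrix.mulVec_transpose]
    have hy' : Tendsto (fun k => Matrix.vecMul w.1 (X k)) atTop (𝓝 0) := hy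
    have he : Tendsto (fun k => -(toComplex L * toComplex C).mulVec (Matrix.vecMul w.1 (X k)))
        atTop (𝓝 0) := by
      have : Continuous fun x : Fin n → ℂ => -(toComplex L * toComplex C).mulVec x := by fun_prop
      simpa [Function.comp_def] using (this.tendsto 0).comp hy'
    refine hB.tendsto_zero (fun k => ?_) he
    rw [hX, Matrix.vecMul_add, ← Matrix.vecMul_vecMul, ← Matrix.vecMul_vecMul, Matrix.vecMul_sub,
      ← Matrix.vecMul_vecMul, hw', Matrix.vecMul_transpose, Matrix.vecMul_transpose,
      Matrix.add_vecMul, Matrix.smul_vecMul, Matrix.add_mulVec, Matrix.smul_mulVec,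
      Matrix.mulVec_sub, Matrix.mulVec_add, Matrix.mulVec_smul]
    module
  have hmem : (Pi.single i 1 - Pi.single j 1 : Fin N → ℂ) ∈ Y := by simp [hYmem]
  have ht : Tendsto (fun k => Matrix.vecMul (Pi.single i 1 - Pi.single j 1) (X k)) atTop (𝓝 0) := by
    have : (⟨_, hmem⟩ : Y) ∈ P := by rw [hP]; trivial
    exact this
  rw [tendsto_pi_nhds] at ht ⊢
  intro a
  have := (Complex.continuous_re.tendsto 0).comp (ht a)
  simpa [Function.comp_def, Matrix.sub_vecMul, hXa] using this

/-- If a network reaches consensus, then `A + (1 - σ) L C` is Schur stable for every eigenvalue `σ`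
of the stochastic matrix that has an eigenvector with two different entries. -/
theorem ReachesConsensus.schurStable {n q N : ℕ} {A : Matrix (Fin n) (Fin n) ℝ}
    {C : Matrix (Fin q) (Fin n) ℝ} {L : Matrix (Fin n) (Fin q) ℝ} {D : Matrix (Fin N) (Fin N) ℝ}
    (h : ReachesConsensus A C L D) (hD : ∀ i, ∑ j, D i j = 1) {σ : ℂ} {v : Fin N → ℂ}
    (hv : (toComplex D).mulVec v = σ • v) {i j : Fin N} (hij : v i ≠ v j) :
    SchurStable (toComplex A + (1 - σ) • (toComplex L * toComplex C)) := by
  rw [schurStable_iff]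
  intro μ w hw hμ
  by_contra! hge
  -- A complex modal solution. The network is real, so its real and imaginary parts are genuine
  -- trajectories.
  let Z : ℕ → Fin N → Fin n → ℂ := fun k i a => v i * μ ^ k * w a
  have hDv : ∀ i, ∑ j, (D i j : ℂ) * v j = σ * v i := fun i => congrFun hv i
  have hZ : ∀ k i a, Z (k + 1) i a = ∑ b, A a b • Z k i b +
      ∑ b, (L * C) a b • ∑ j, D i j • (Z k i b - Z k j b) := by
    intro k i a
    have h1 : ∀ b, ∑ j, D i j • (Z k i b - Z k j b) = (1 - σ) * (v i * μ ^ k * w b) := by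
      intro b
      have h2 : ∑ j, (D i j : ℂ) = 1 := by exact_mod_cast hD i
      have h3 : ∀ j, D i j • (Z k i b - Z k j b) =
          (D i j : ℂ) * (v i * μ ^ k * w b) - (D i j : ℂ) * v j * (μ ^ k * w b) := by
        intro j
        simp only [Z, Complex.real_smul]
        ring
      rw [Finset.sum_congr rfl fun j _ => h3 j, Finset.sum_sub_distrib, ← Finset.sum_mul,
        ← Finset.sum_mul, h2, hDv]
      ring
    have h4 := congrFun hμ a
    rw [← toComplex_mul, Matrix.add_mulVec, Matrix.smul_mulVec] at h4
    simp only [Pi.add_apply, Pi.smul_apply, smul_eq_mul, Matrix.mulVec, dotProduct, toComplex,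
      Matrix.map_apply] at h4
    simp only [h1]
    simp only [Complex.real_smul, Z]
    calc v i * μ ^ (k + 1) * w a = v i * μ ^ k * (μ * w a) := by ring
      _ = _ := by
        rw [← h4, mul_add, Finset.mul_sum, ← mul_assoc, Finset.mul_sum]
        congr 1 <;> exact Finset.sum_congr rfl fun b _ => by ring
  have hφ : ∀ φ : ℂ →L[ℝ] ℝ, ∀ a, Tendsto (fun k => φ (Z k i a) - φ (Z k j a)) atTop (𝓝 0) := by
    intro φ a
    have htraj : IsNetworkTrajectory A C L D fun k i a => φ (Z k i a) := by
      intro k i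
      ext a
      change φ (Z (k + 1) i a) = _
      rw [hZ]
      simp only [map_add, map_sum, map_smul, map_sub, smul_eq_mul]
      simp [Matrix.mulVec, dotProduct]
    simpa using (tendsto_pi_nhds.1 (h _ htraj i j)) a
  obtain ⟨a, ha⟩ := Function.ne_iff.1 hw
  have hre := hφ Complex.reCLM a
  have him := hφ Complex.imCLM a
  have hsum := ((Complex.continuous_ofReal.tendsto 0).comp hre).add
    (((Complex.continuous_ofReal.tendsto 0).comp him).mul_const Complex.I)
  have hlim : Tendsto (fun k => Z k i a - Z k j a) atTop (𝓝 0) := by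
    have : ∀ k, Z k i a - Z k j a = ((Complex.reCLM (Z k i a) - Complex.reCLM (Z k j a) : ℝ) : ℂ) +
        ((Complex.imCLM (Z k i a) - Complex.imCLM (Z k j a) : ℝ) : ℂ) * Complex.I := by
      intro k
      apply Complex.ext <;> simp
    simp only [this]
    simpa [Function.comp_def] using hsum
  have hpos : 0 < ‖(v i - v j) * w a‖ := norm_pos_iff.2 (mul_ne_zero (sub_ne_zero.2 hij) ha)
  obtain ⟨k, hk⟩ := (hlim.norm.eventually (gt_mem_nhds (by simpa using hpos))).exists
  have : Z k i a - Z k j a = μ ^ k * ((v i - v j) * w a) := by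
    simp only [Z]
    ring
  rw [this, norm_mul, norm_pow, norm_mul] at hk
  rw [norm_mul] at hpos
  have h1 := one_le_pow₀ hge (n := k)
  nlinarith

/-! ### Realizing every point of the disk by a stochastic matrix -/

theorem mem_spanningTreeGraphs_complete {N : ℕ} (hN : 0 < N) :
    (⟨fun i j => i ≠ j⟩ : Digraph (Fin N)) ∈ spanningTreeGraphs N :=
  ⟨fun _ h => h rfl, ⟨0, hN⟩, fun _ hi => Relation.TransGen.single hi.symm⟩

theorem isStochasticMatrixOf_complete {N : ℕ} {D : Matrix (Fin N) (Fin N) ℝ}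
    (h0 : ∀ i j, 0 < D i j) (h1 : ∀ i, ∑ j, D i j = 1) :
    IsStochasticMatrixOf D ⟨fun i j => i ≠ j⟩ :=
  ⟨fun i => h0 i i, fun i j _ _ => h0 i j, fun _ _ hij h => absurd hij.symm h, h1⟩

/-- The square with vertices `1, i, -1, -i` contains the disk of radius `1/2`: perturb the uniform
weights `1/4` by half the real and imaginary parts. -/
theorem exists_convex_combination_roots (z : ℂ) (hz : ‖z‖ ≤ 1 / 2) :
    ∃ w : Fin 4 → ℝ, (∀ b, 0 ≤ w b) ∧ ∑ b, w b = 1 ∧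
      ∑ b, (w b : ℂ) * Complex.I ^ (b : ℕ) = z := by
  have hre := abs_le.1 ((Complex.abs_re_le_norm z).trans hz)
  have him := abs_le.1 ((Complex.abs_im_le_norm z).trans hz)
  refine ⟨![1 / 4 + z.re / 2, 1 / 4 + z.im / 2, 1 / 4 - z.re / 2, 1 / 4 - z.im / 2], ?_, ?_, ?_⟩
  · intro b
    fin_cases b <;> simp <;> linarith
  · simp [Fin.sum_univ_four]
    ring
  · have h3 : Complex.I ^ 3 = -Complex.I := Complex.I_pow_three
    apply Complex.ext <;> simp [Fin.sum_univ_four, h3] <;> ring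

/-- Every point of the open unit disk is an eigenvalue, with a non-constant eigenvector, of a
stochastic matrix with positive entries. -/
theorem exists_stochastic_eigenvalue {σ : ℂ} (hσ : ‖σ‖ < 1) :
    ∃ (ι : Type) (_ : Fintype ι) (D : Matrix ι ι ℝ) (v : ι → ℂ), (∀ i j, 0 < D i j) ∧
      (∀ i, ∑ j, D i j = 1) ∧ (∀ i, ∑ j, (D i j : ℂ) * v j = σ * v i) ∧ ∃ i j, v i ≠ v j := by
  -- The gap `1 - ρ` is the weight of the uniform matrix mixed in later to make all entries
  -- positive; the rest must realize `τ = σ / ρ`.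
  obtain ⟨ρ, hρσ, hρ1⟩ := exists_between hσ
  have hρ0 : 0 < ρ := (norm_nonneg σ).trans_lt hρσ
  set τ : ℂ := σ / ρ with hτdef
  have hτ : ‖τ‖ < 1 := by
    rw [hτdef, norm_div, Complex.norm_real, Real.norm_of_nonneg hρ0.le, div_lt_one hρ0]
    exact hρσ
  have hστ : (ρ : ℂ) * τ = σ := by
    rw [hτdef]
    have : (ρ : ℂ) ≠ 0 := by exact_mod_cast hρ0.ne'
    field_simp
  obtain ⟨m, hm⟩ : ∃ m, ‖τ‖ ^ (m + 1) ≤ 1 / 2 := by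
    obtain ⟨m, hm⟩ := exists_pow_lt_of_lt_one (show (0 : ℝ) < 1 / 2 by norm_num) hτ
    exact ⟨m, (pow_le_pow_of_le_one (norm_nonneg τ) hτ.le (Nat.le_succ m)).trans hm.le⟩
  -- Multiplication by `τ` moves each point to the next on its spiral. By the choice of `m`, the
  -- last ones land in the hull of the four roots of unity. Thus `τ v p` is always a convex
  -- combination of the `v s`. Since `v` sums to zero, the uniform matrix annihilates it.
  let v : Fin 4 × Fin (m + 1) → ℂ := fun p => Complex.I ^ (p.1 : ℕ) * τ ^ (p.2 : ℕ)
  have hv : ∑ p, v p = 0 := by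
    simp only [v, Fintype.sum_prod_type, ← Finset.mul_sum, ← Finset.sum_mul]
    simp [Fin.sum_univ_four]
  have hrow : ∀ p, ∃ w : Fin 4 × Fin (m + 1) → ℝ, (∀ s, 0 ≤ w s) ∧ ∑ s, w s = 1 ∧
      ∑ s, (w s : ℂ) * v s = τ * v p := by
    rintro ⟨a, j⟩
    by_cases hj : (j : ℕ) + 1 < m + 1
    · refine ⟨Pi.single (a, ⟨j + 1, hj⟩) 1, fun s => ?_, by simp, ?_⟩
      · by_cases hs : s = (a, ⟨j + 1, hj⟩)
        · subst hs
          simp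
        · simp [Pi.single_eq_of_ne hs]
      · rw [Finset.sum_eq_single (a, ⟨j + 1, hj⟩)]
        · simp [v, pow_succ]
          ring
        · intro b _ hb
          simp [Pi.single_eq_of_ne hb]
        · simp
    · have hjm : (j : ℕ) = m := by omega
      obtain ⟨w, hw0, hw1, hw⟩ := exists_convex_combination_roots
        (Complex.I ^ (a : ℕ) * τ ^ (m + 1)) (by simpa using hm)
      refine ⟨fun s => if s.2 = 0 then w s.1 else 0, fun s => ?_, ?_, ?_⟩
      · dsimp only
        split_ifs
        exacts [hw0 _, le_rfl]
      · simp [Fintype.sum_prod_type, hw1]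
      · simp only [Fintype.sum_prod_type, v]
        have : ∀ b : Fin 4, ∑ l : Fin (m + 1), (((if l = 0 then w b else 0 : ℝ)) : ℂ) *
            (Complex.I ^ (b : ℕ) * τ ^ (l : ℕ)) = (w b : ℂ) * Complex.I ^ (b : ℕ) := by
          intro b
          rw [Finset.sum_eq_single 0]
          · simp
          · intro l _ hl
            simp [hl]
          · simp
        rw [Finset.sum_congr rfl fun b _ => this b, hw, hjm]
        ring
  choose Q hQ0 hQ1 hQ using hrow
  set c : ℝ := ((Fintype.card (Fin 4 × Fin (m + 1)) : ℕ) : ℝ) with hc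
  have hc0 : 0 < c := by
    rw [hc]
    exact_mod_cast Fintype.card_pos
  refine ⟨Fin 4 × Fin (m + 1), inferInstance, fun p s => (1 - ρ) / c + ρ * Q p s, v, ?_, ?_, ?_,
    (0, 0), (2, 0), ?_⟩
  · intro p s
    have := div_pos (sub_pos.2 hρ1) hc0
    have := mul_nonneg hρ0.le (hQ0 p s)
    linarith
  · intro p
    rw [Finset.sum_add_distrib, ← Finset.mul_sum, hQ1, Finset.sum_const, Finset.card_univ,
      nsmul_eq_mul, ← hc]
    field_simp
    ring
  · intro p
    push_cast
    simp only [add_mul, Finset.sum_add_distrib, ← Finset.mul_sum, mul_assoc, hv, hQ]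
    rw [← hστ]
    ring
  · simp [v]
    norm_num

/-- If the network reaches consensus for any number of agents, then its consensus region contains
the open unit disk. -/
theorem ball_subset_of_reachesConsensus {n q : ℕ} {A : Matrix (Fin n) (Fin n) ℝ}
    {C : Matrix (Fin q) (Fin n) ℝ} {L : Matrix (Fin n) (Fin q) ℝ}
    (h : ∀ N, ReachesConsensusForAllTopologies A C L N) :
    Metric.ball (0 : ℂ) 1 ⊆ consensusRegion A C L := by
  intro σ hσ
  obtain ⟨ι, _, D, v, h0, h1, hv, i, j, hij⟩ :=
    exists_stochastic_eigenvalue (by simpa using hσ)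
  let e := Fintype.equivFin ι
  have hrow : ∀ a, ∑ b, D.submatrix e.symm e.symm a b = 1 := by
    intro a
    simp only [Matrix.submatrix_apply]
    rw [e.symm.sum_comp fun b => D (e.symm a) b, h1]
  refine (h _ _ (mem_spanningTreeGraphs_complete (Fintype.card_pos_iff.2 ⟨i⟩)) _
    (isStochasticMatrixOf_complete (D := D.submatrix e.symm e.symm) (fun _ _ => h0 _ _)
      hrow)).schurStable hrow (v := v ∘ e.symm) ?_ (i := e i) (j := e j) (by simpa using hij)
  ext a
  simp only [Matrix.mulVec, dotProduct, toComplex, Matrix.map_apply, Matrix.submatrix_apply,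
    Function.comp_apply, Pi.smul_apply, smul_eq_mul]
  rw [e.symm.sum_comp fun b => (D (e.symm a) b : ℂ) * v b, hv]

/-! ### Necessity of detectability -/

theorem detectable_of_zero_mem {n q : ℕ} {A : Matrix (Fin n) (Fin n) ℝ}
    {C : Matrix (Fin q) (Fin n) ℝ} {L : Matrix (Fin n) (Fin q) ℝ}
    (h : (0 : ℂ) ∈ consensusRegion A C L) : Detectable A C := by
  refine ⟨L, ?_⟩
  have h1 : SchurStable (toComplex A + (1 - (0 : ℂ)) • (toComplex L * toComplex C)) := h
  rw [sub_zero, one_smul, ← toComplex_mul] at h1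
  have : toComplex (A + L * C) = toComplex A + toComplex (L * C) := by
    ext
    simp [toComplex]
  rwa [this]

theorem ReachesConsensusForAllTopologies.detectable {n q N : ℕ} {A : Matrix (Fin n) (Fin n) ℝ}
    {C : Matrix (Fin q) (Fin n) ℝ} {L : Matrix (Fin n) (Fin q) ℝ} (hN : 2 ≤ N)
    (h : ReachesConsensusForAllTopologies A C L N) : Detectable A C := by
  have hN0 : (N : ℝ) ≠ 0 := by
    have : N ≠ 0 := by omega
    exact_mod_cast this
  let D : Matrix (Fin N) (Fin N) ℝ := Matrix.of fun _ _ => (N : ℝ)⁻¹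
  have hrow : ∀ i, ∑ j, D i j = 1 := by
    intro i
    simp [D, hN0]
  have hpos : ∀ i j, 0 < D i j := by
    intro i j
    have : 0 < N := by omega
    exact inv_pos.2 (by exact_mod_cast this)
  have hne : (⟨1, by omega⟩ : Fin N) ≠ ⟨0, by omega⟩ := by simp
  refine detectable_of_zero_mem (L := L) ((h _ (mem_spanningTreeGraphs_complete (by omega)) _
    (isStochasticMatrixOf_complete hpos hrow)).schurStable hrow
    (v := Pi.single ⟨0, by omega⟩ 1 - Pi.single ⟨1, by omega⟩ 1) ?_
    (i := ⟨0, by omega⟩) (j := ⟨1, by omega⟩) ?_)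
  · ext a
    simp [Matrix.mulVec_sub, toComplex, D]
  · simp [hne, hne.symm]
    norm_num

/-! ### Norm identities and the complexified closed loop -/

/-- The square of the Euclidean norm of a complex vector. -/
noncomputable def sqNorm {n : ℕ} (x : Fin n → ℂ) : ℝ := ∑ i, ‖x i‖ ^ 2

theorem sqNorm_nonneg {n : ℕ} (x : Fin n → ℂ) : 0 ≤ sqNorm x :=
  Finset.sum_nonneg fun _ _ => sq_nonneg _

theorem sqNorm_eq_zero {n : ℕ} {x : Fin n → ℂ} : sqNorm x = 0 ↔ x = 0 := by
  rw [sqNorm, Finset.sum_eq_zero_iff_of_nonneg fun _ _ => sq_nonneg _, funext_iff]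
  simp

theorem sqNorm_smul {n : ℕ} (c : ℂ) (x : Fin n → ℂ) : sqNorm (c • x) = ‖c‖ ^ 2 * sqNorm x := by
  simp [sqNorm, mul_pow, Finset.mul_sum]

theorem coe_sqNorm {n : ℕ} (x : Fin n → ℂ) : (sqNorm x : ℂ) = star x ⬝ᵥ x := by
  simp only [sqNorm, dotProduct, Pi.star_apply, Complex.star_def, Complex.conj_mul']
  push_cast
  rfl

theorem sqNorm_add {n : ℕ} {x y : Fin n → ℂ} (h : star x ⬝ᵥ y = 0) :
    sqNorm (x + y) = sqNorm x + sqNorm y := by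
  have h' : star y ⬝ᵥ x = 0 := by
    rw [Matrix.star_dotProduct, h, star_zero]
  apply Complex.ofReal_injective
  push_cast
  simp only [coe_sqNorm]
  simp [add_dotProduct, dotProduct_add, h, h']

theorem sqNorm_mulVec {n : ℕ} {M : Matrix (Fin n) (Fin n) ℂ} (hM : Mᴴ * M = 1) (x : Fin n → ℂ) :
    sqNorm (M *ᵥ x) = sqNorm x := by
  apply Complex.ofReal_injective
  rw [coe_sqNorm, coe_sqNorm, Matrix.star_mulVec, ← Matrix.dotProduct_mulVec, Matrix.mulVec_mulVec,
    hM, Matrix.one_mulVec]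

theorem continuous_sqNorm {n : ℕ} : Continuous (sqNorm (n := n)) := by
  unfold sqNorm
  fun_prop

/-- The map fixes the component orthogonal to range `P` and scales the component `P x` by `σ`; apply
Pythagoras. -/
theorem sqNorm_sub_smul_projection {n : ℕ} {P : Matrix (Fin n) (Fin n) ℂ} (hP : Pᴴ = P)
    (hPP : P * P = P) (σ : ℂ) (x : Fin n → ℂ) :
    sqNorm (x - (1 - σ) • (P *ᵥ x)) = sqNorm x - (1 - ‖σ‖ ^ 2) * sqNorm (P *ᵥ x) := by
  have horth : star (x - P *ᵥ x) ⬝ᵥ (P *ᵥ x) = 0 := by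
    rw [star_sub, Matrix.star_mulVec, hP, sub_dotProduct, ← Matrix.dotProduct_mulVec,
      Matrix.mulVec_mulVec, hPP, sub_self]
  have h1 : x - (1 - σ) • (P *ᵥ x) = (x - P *ᵥ x) + σ • (P *ᵥ x) := by module
  have h2 : sqNorm x = sqNorm (x - P *ᵥ x) + sqNorm (P *ᵥ x) := by
    rw [← sqNorm_add horth, sub_add_cancel]
  rw [h1, sqNorm_add (by rw [dotProduct_smul, horth, smul_zero]), sqNorm_smul]
  linarith

theorem toComplex_add {m n : ℕ} (A B : Matrix (Fin m) (Fin n) ℝ) :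
    toComplex (A + B) = toComplex A + toComplex B := by
  ext
  simp [toComplex]

theorem toComplex_neg {m n : ℕ} (A : Matrix (Fin m) (Fin n) ℝ) :
    toComplex (-A) = -toComplex A := by
  ext
  simp [toComplex]

@[simp]
theorem toComplex_zero {m n : ℕ} : toComplex (0 : Matrix (Fin m) (Fin n) ℝ) = 0 := by
  ext
  simp [toComplex]

@[simp]
theorem toComplex_one {n : ℕ} : toComplex (1 : Matrix (Fin n) (Fin n) ℝ) = 1 :=
  Matrix.map_one _ Complex.ofReal_zero Complex.ofReal_one

theorem toComplex_transpose {m n : ℕ} (A : Matrix (Fin m) (Fin n) ℝ) :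
    toComplex A.transpose = (toComplex A)ᴴ := by
  ext
  simp [toComplex]

/-- The structure of the closed loop in the coordinates that split the state space into the
marginally stable and the Schur stable part, over the complex numbers. -/
structure SplitGain {n q : ℕ} (A : Matrix (Fin n) (Fin n) ℂ) (C : Matrix (Fin q) (Fin n) ℂ)
    (L : Matrix (Fin n) (Fin q) ℂ) (n₁ n₂ : ℕ) where
  U : Matrix (Fin n) (Fin n₁) ℂ
  W : Matrix (Fin n) (Fin n₂) ℂ
  T₁ : Matrix (Fin n₁) (Fin n) ℂ
  T₂ : Matrix (Fin n₂) (Fin n) ℂ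
  M : Matrix (Fin n₁) (Fin n₁) ℂ
  X : Matrix (Fin n₂) (Fin n₂) ℂ
  P : Matrix (Fin n₁) (Fin n₁) ℂ
  K : Matrix (Fin n₁) (Fin q) ℂ
  sum_eq : U * T₁ + W * T₂ = 1
  T₁_mul_U : T₁ * U = 1
  T₂_mul_U : T₂ * U = 0
  T₂_mul_W : T₂ * W = 1
  A_mul_U : A * U = U * M
  A_mul_W : A * W = W * X
  isometry : Mᴴ * M = 1
  schur : SchurStable X
  P_star : Pᴴ = P
  P_mul_P : P * P = P
  C_mul_U : C * U * P = C * U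
  L_eq : L = U * K
  L_mul_C_mul_U : L * C * U = -(U * M * P)

/-- Take `P = Vᵀ V`. It fixes range `Vᵀ`, which is the range of `(CU)ᵀ`, so `CU P = CU`. The left
inverse then gives `S C U = V`, whence `L C U = -U M P`. -/
theorem IsAlgorithmGain.nonempty_splitGain {n q : ℕ} {A : Matrix (Fin n) (Fin n) ℝ}
    {C : Matrix (Fin q) (Fin n) ℝ} {L : Matrix (Fin n) (Fin q) ℝ} (h : IsAlgorithmGain A C L) :
    ∃ n₁ n₂, Nonempty (SplitGain (toComplex A) (toComplex C) (toComplex L) n₁ n₂) := by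
  obtain ⟨n₁, n₂, m, U, W, T, M, X, V, S, hT1, hT2, hTA, hM, hX, hV, hrange, hS, rfl⟩ := h
  have hP : V.transpose * V * (U.transpose * C.transpose) = U.transpose * C.transpose := by
    refine Matrix.ext_of_mulVec_single fun i => ?_
    have hmem : (U.transpose * C.transpose) *ᵥ Pi.single i 1 ∈
        LinearMap.range V.transpose.mulVecLin := by
      rw [hrange]
      exact ⟨_, rfl⟩
    obtain ⟨y, hy⟩ := hmem
    rw [Matrix.mulVecLin_apply] at hy
    rw [← Matrix.mulVec_mulVec, ← hy, Matrix.mulVec_mulVec, Matrix.mul_assoc, hV, Matrix.mul_one]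
  have hCU : C * U * (V.transpose * V) = C * U := by
    have := congrArg Matrix.transpose hP
    simpa [Matrix.transpose_mul, Matrix.mul_assoc] using this
  have hSV : S * C * U = V := by
    calc S * C * U = S * (C * U * (V.transpose * V)) := by rw [hCU, Matrix.mul_assoc]
      _ = S * (C * U * V.transpose) * V := by simp only [Matrix.mul_assoc]
      _ = V := by rw [hS, Matrix.one_mul]
  obtain ⟨T₁, T₂, rfl⟩ : ∃ T₁ T₂, T = Matrix.fromRows T₁ T₂ :=
    ⟨T.toRows₁, T.toRows₂, (Matrix.fromRows_toRows T).symm⟩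
  rw [Matrix.fromRows_mul_fromCols, ← Matrix.fromBlocks_one, Matrix.fromBlocks_inj] at hT1
  rw [Matrix.fromCols_mul_fromRows] at hT2
  have hAUW : A * Matrix.fromCols U W = Matrix.fromCols U W * Matrix.fromBlocks M 0 0 X := by
    rw [← hTA, Matrix.mul_assoc, ← Matrix.mul_assoc (Matrix.fromCols U W),
      Matrix.fromCols_mul_fromRows, hT2, Matrix.one_mul]
  rw [Matrix.mul_fromCols, Matrix.fromCols_mul_fromBlocks] at hAUW
  replace hAUW := Matrix.fromCols_inj hAUW
  simp only [Matrix.mul_zero, add_zero, zero_add] at hAUW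
  have hLCU : -(U * M * V.transpose * S) * C * U = -(U * M * (V.transpose * V)) := by
    rw [Matrix.neg_mul, Matrix.neg_mul, Matrix.mul_assoc, Matrix.mul_assoc, ← Matrix.mul_assoc S,
      hSV, Matrix.mul_assoc]
  have hMM : M.transpose * M = 1 := (Matrix.mem_orthogonalGroup_iff' _ _).1 hM
  refine ⟨n₁, n₂, ⟨toComplex U, toComplex W, toComplex T₁, toComplex T₂, toComplex M, toComplex X,
    toComplex (V.transpose * V), toComplex (-(M * V.transpose * S)), ?_, ?_, ?_, ?_, ?_, ?_, ?_, hX,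
    ?_, ?_, ?_, ?_, ?_⟩⟩
  · rw [← toComplex_mul, ← toComplex_mul, ← toComplex_add, hT2, toComplex_one]
  · rw [← toComplex_mul, hT1.1, toComplex_one]
  · rw [← toComplex_mul, hT1.2.2.1, toComplex_zero]
  · rw [← toComplex_mul, hT1.2.2.2, toComplex_one]
  · rw [← toComplex_mul, ← toComplex_mul, hAUW.1]
  · rw [← toComplex_mul, ← toComplex_mul, hAUW.2]
  · rw [← toComplex_transpose, ← toComplex_mul, hMM, toComplex_one]
  · rw [← toComplex_transpose]
    simp
  · rw [← toComplex_mul, Matrix.mul_assoc, ← Matrix.mul_assoc V, hV, Matrix.one_mul]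
  · rw [← toComplex_mul, ← toComplex_mul, hCU]
  · rw [← toComplex_mul, Matrix.mul_neg]
    simp only [Matrix.mul_assoc]
  · rw [← toComplex_mul, ← toComplex_mul, hLCU, toComplex_neg, toComplex_mul, toComplex_mul]

namespace SplitGain

variable {n q n₁ n₂ : ℕ} {A : Matrix (Fin n) (Fin n) ℂ} {C : Matrix (Fin q) (Fin n) ℂ}
  {L : Matrix (Fin n) (Fin q) ℂ}

theorem T₂_mul (g : SplitGain A C L n₁ n₂) (σ : ℂ) : g.T₂ * (A + (1 - σ) • (L * C)) = g.X * g.T₂ := by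
  have hA : A = g.U * g.M * g.T₁ + g.W * g.X * g.T₂ := by
    rw [← g.A_mul_U, ← g.A_mul_W, Matrix.mul_assoc, Matrix.mul_assoc, ← Matrix.mul_add, g.sum_eq,
      Matrix.mul_one]
  have h1 : g.T₂ * A = g.X * g.T₂ := by
    refine (congrArg (g.T₂ * ·) hA).trans ?_
    simp only [Matrix.mul_add, ← Matrix.mul_assoc, g.T₂_mul_U, g.T₂_mul_W]
    simp
  have h2 : g.T₂ * L = 0 := by
    refine (congrArg (g.T₂ * ·) g.L_eq).trans ?_
    simp only [← Matrix.mul_assoc, g.T₂_mul_U, Matrix.zero_mul]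
  rw [Matrix.mul_add, Matrix.mul_smul, h1, ← Matrix.mul_assoc, h2]
  simp

theorem mulVec_U (g : SplitGain A C L n₁ n₂) (σ : ℂ) (a : Fin n₁ → ℂ) : (A + (1 - σ) • (L * C)) *ᵥ (g.U *ᵥ a) =
    g.U *ᵥ (g.M *ᵥ (a - (1 - σ) • (g.P *ᵥ a))) := by
  rw [Matrix.mulVec_mulVec, Matrix.add_mul, Matrix.smul_mul, g.L_mul_C_mul_U, g.A_mul_U]
  simp only [Matrix.mulVec_sub, Matrix.mulVec_smul, Matrix.mulVec_mulVec, Matrix.add_mulVec,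
    Matrix.smul_mulVec, Matrix.neg_mulVec, Matrix.mul_assoc]
  module

theorem eq_mulVec_U (g : SplitGain A C L n₁ n₂) {v : Fin n → ℂ} (hv : g.T₂ *ᵥ v = 0) : v = g.U *ᵥ (g.T₁ *ᵥ v) := by
  have := congrArg (· *ᵥ v) g.sum_eq
  simpa [Matrix.add_mulVec, ← Matrix.mulVec_mulVec, hv] using this.symm

theorem T₁_mulVec_U (g : SplitGain A C L n₁ n₂) (a : Fin n₁ → ℂ) : g.T₁ *ᵥ (g.U *ᵥ a) = a := by
  rw [Matrix.mulVec_mulVec, g.T₁_mul_U, Matrix.one_mulVec]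

/-- An eigenvector with `T₂ v ≠ 0` passes its eigenvalue to `X`. Otherwise `v = U a`, and `‖μ‖ ≥ 1`
in the norm identity forces `P a = 0`, hence `C v = 0`; then `v` is an eigenvector of `A + L' C` for
the same `μ`. -/
theorem schurStable (g : SplitGain A C L n₁ n₂) {L' : Matrix (Fin n) (Fin q) ℂ} (hL' : SchurStable (A + L' * C)) {σ : ℂ}
    (hσ : ‖σ‖ < 1) : SchurStable (A + (1 - σ) • (L * C)) := by
  rw [schurStable_iff]
  intro μ v hv hμ
  by_cases hb : g.T₂ *ᵥ v = 0
  · by_contra! hge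
    have hva := g.eq_mulVec_U hb
    set a := g.T₁ *ᵥ v with ha
    have hMa : g.M *ᵥ (a - (1 - σ) • (g.P *ᵥ a)) = μ • a := by
      rw [← g.T₁_mulVec_U (g.M *ᵥ _), ← g.mulVec_U, ← hva, hμ, Matrix.mulVec_smul]
    have hN := congrArg sqNorm hMa
    rw [sqNorm_mulVec g.isometry, sqNorm_sub_smul_projection g.P_star g.P_mul_P, sqNorm_smul] at hN
    have hPa : g.P *ᵥ a = 0 := by
      rw [← sqNorm_eq_zero]
      have h1 := sqNorm_nonneg (g.P *ᵥ a)
      have h2 := sqNorm_nonneg a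
      have h3 : 0 < 1 - ‖σ‖ ^ 2 := by nlinarith [norm_nonneg σ]
      have h4 : 1 ≤ ‖μ‖ ^ 2 := one_le_pow₀ hge
      nlinarith
    have hCv : C *ᵥ v = 0 := by
      rw [hva, Matrix.mulVec_mulVec, ← g.C_mul_U, ← Matrix.mulVec_mulVec, hPa, Matrix.mulVec_zero]
    refine absurd (schurStable_iff.1 hL' μ v hv ?_) (not_lt.2 hge)
    rw [Matrix.add_mulVec, Matrix.smul_mulVec, ← Matrix.mulVec_mulVec, hCv] at hμ
    rw [Matrix.add_mulVec, ← Matrix.mulVec_mulVec, hCv]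
    simpa using hμ
  · refine schurStable_iff.1 g.schur μ _ hb ?_
    rw [Matrix.mulVec_mulVec, ← g.T₂_mul σ, ← Matrix.mulVec_mulVec, hμ, Matrix.mulVec_smul]

/-- An unstable eigenvector of `A` lies in range `U`. Its orbit under the closed loop stays there
with nondecreasing norm in the coordinates `a`, so it cannot tend to zero. -/
theorem not_schurStable (g : SplitGain A C L n₁ n₂) (hA : ¬ SchurStable A) {σ : ℂ} (hσ : 1 ≤ ‖σ‖) :
    ¬ SchurStable (A + (1 - σ) • (L * C)) := by
  intro hB
  rw [schurStable_iff] at hA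
  push Not at hA
  obtain ⟨μ, v, hv, hμv, hμ⟩ := hA
  have hT₂v : g.T₂ *ᵥ v = 0 := by
    by_contra hne
    refine absurd (schurStable_iff.1 g.schur μ _ hne ?_) (not_lt.2 hμ)
    have h1 := g.T₂_mul 1
    rw [sub_self, zero_smul, add_zero] at h1
    rw [Matrix.mulVec_mulVec, ← h1, ← Matrix.mulVec_mulVec, hμv, Matrix.mulVec_smul]
  let a : ℕ → Fin n₁ → ℂ := fun k =>
    (fun x => g.M *ᵥ (x - (1 - σ) • (g.P *ᵥ x)))^[k] (g.T₁ *ᵥ v)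
  have ha : ∀ k, a (k + 1) = g.M *ᵥ (a k - (1 - σ) • (g.P *ᵥ a k)) := fun k =>
    Function.iterate_succ_apply' _ _ _
  have hmono : Monotone fun k => sqNorm (a k) := by
    refine monotone_nat_of_le_succ fun k => ?_
    rw [ha, sqNorm_mulVec g.isometry, sqNorm_sub_smul_projection g.P_star g.P_mul_P]
    have h1 := sqNorm_nonneg (g.P *ᵥ a k)
    have h2 : 1 ≤ ‖σ‖ ^ 2 := one_le_pow₀ hσ
    nlinarith
  have hz : Tendsto (fun k => g.U *ᵥ a k) atTop (𝓝 0) :=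
    hB.tendsto_zero (e := fun _ => 0) (fun k => by rw [g.mulVec_U, ha, add_zero]) tendsto_const_nhds
  have hcont : Continuous fun x : Fin n → ℂ => sqNorm (g.T₁ *ᵥ x) :=
    continuous_sqNorm.comp (by fun_prop)
  have hlim : Tendsto (fun k => sqNorm (a k)) atTop (𝓝 0) := by
    have := (hcont.tendsto 0).comp hz
    simpa [Function.comp_def, g.T₁_mulVec_U, sqNorm_eq_zero.2] using this
  have h0 : sqNorm (a 0) = 0 :=
    le_antisymm (hmono.ge_of_tendsto hlim 0) (sqNorm_nonneg _)
  have h1 : g.T₁ *ᵥ v = 0 := sqNorm_eq_zero.1 h0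
  exact hv (by rw [g.eq_mulVec_U hT₂v, h1, Matrix.mulVec_zero])

end SplitGain

theorem IsAlgorithmGain.ball_subset {n q : ℕ} {A : Matrix (Fin n) (Fin n) ℝ}
    {C : Matrix (Fin q) (Fin n) ℝ} {L : Matrix (Fin n) (Fin q) ℝ} (h : IsAlgorithmGain A C L)
    (hd : Detectable A C) : Metric.ball (0 : ℂ) 1 ⊆ consensusRegion A C L := by
  obtain ⟨n₁, n₂, ⟨g⟩⟩ := h.nonempty_splitGain
  obtain ⟨L', hL'⟩ := hd
  rw [toComplex_add, toComplex_mul] at hL'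
  exact fun σ hσ => g.schurStable hL' (by simpa using hσ)

theorem IsAlgorithmGain.consensusRegion_eq {n q : ℕ} {A : Matrix (Fin n) (Fin n) ℝ}
    {C : Matrix (Fin q) (Fin n) ℝ} {L : Matrix (Fin n) (Fin q) ℝ} (h : IsAlgorithmGain A C L)
    (hd : Detectable A C) (hA : ¬ SchurStable (toComplex A)) :
    consensusRegion A C L = Metric.ball (0 : ℂ) 1 := by
  refine Set.Subset.antisymm (fun σ hσ => ?_) (h.ball_subset hd)
  obtain ⟨n₁, n₂, ⟨g⟩⟩ := h.nonempty_splitGain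
  by_contra hσ1
  exact g.not_schurStable hA (by simpa using hσ1) hσ

/-! ### Bounded powers and their idempotent limits -/

/-- The powers of a neutrally stable matrix are bounded. -/
theorem NeutrallyStable.exists_pow_bound {n : ℕ} {A : Matrix (Fin n) (Fin n) ℂ}
    (hA : NeutrallyStable A) : ∃ c, ∀ k i j, ‖(A ^ k) i j‖ ≤ c := by
  let P : Submodule ℂ (Fin n → ℂ) :=
    { carrier := {v | ∃ c, ∀ k, ‖(A ^ k) *ᵥ v‖ ≤ c}
      zero_mem' := ⟨0, by simp⟩
      add_mem' := by
        rintro a b ⟨c, hc⟩ ⟨d, hd⟩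
        refine ⟨c + d, fun k => ?_⟩
        rw [Matrix.mulVec_add]
        exact (norm_add_le _ _).trans (add_le_add (hc k) (hd k))
      smul_mem' := by
        rintro r a ⟨c, hc⟩
        refine ⟨‖r‖ * c, fun k => ?_⟩
        rw [Matrix.mulVec_smul, norm_smul]
        exact mul_le_mul_of_nonneg_left (hc k) (norm_nonneg r) }
  have hP : P = ⊤ := by
    rw [eq_top_iff, ← Module.End.iSup_maxGenEigenspace_eq_top (Matrix.toLin' A)]
    refine iSup_le fun σ => ?_
    by_cases hσ : σ ∈ spectrum ℂ A ∧ ‖σ‖ = 1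
    · rw [(hA σ hσ.1).2 hσ.2]
      intro y hy
      rw [Module.End.mem_eigenspace_iff, Matrix.toLin'_apply] at hy
      refine ⟨‖y‖, fun k => ?_⟩
      induction k with
      | zero => simp
      | succ k ih => rwa [pow_succ, ← Matrix.mulVec_mulVec, hy, Matrix.mulVec_smul, norm_smul, hσ.2,
          one_mul]
    · refine Module.End.maxGenEigenspace_le _ P σ fun hσe y hy => ?_
      rw [Module.End.hasEigenvalue_iff_mem_spectrum, Matrix.spectrum_toLin'] at hσe
      have hσ1 : ‖σ‖ < 1 := lt_of_le_of_ne (hA σ hσe).1 fun h => hσ ⟨hσe, h⟩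
      obtain ⟨c, hc⟩ := hy
      -- This bound `d` satisfies `c + ‖σ‖ d ≤ d`, so it propagates through the recursion.
      refine ⟨max ‖y‖ (c / (1 - ‖σ‖)), fun k => ?_⟩
      set d := max ‖y‖ (c / (1 - ‖σ‖)) with hd
      induction k with
      | zero => simp [hd]
      | succ k ih =>
        have h1 : (A ^ (k + 1)) *ᵥ y =
            (A ^ k) *ᵥ (Matrix.toLin' A y - σ • y) + σ • ((A ^ k) *ᵥ y) := by
          rw [pow_succ, ← Matrix.mulVec_mulVec, Matrix.toLin'_apply, Matrix.mulVec_sub,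
            Matrix.mulVec_smul, sub_add_cancel]
        have h2 : c ≤ (1 - ‖σ‖) * d := by
          rw [← div_le_iff₀' (by linarith)]
          exact le_max_right _ _
        rw [h1]
        refine (norm_add_le _ _).trans ?_
        rw [norm_smul]
        have := mul_le_mul_of_nonneg_left ih (norm_nonneg σ)
        linarith [hc k]
  have hex : ∀ j, ∃ c, ∀ k, ‖(A ^ k) *ᵥ Pi.single j 1‖ ≤ c := by
    intro j
    have : (Pi.single j 1 : Fin n → ℂ) ∈ P := by rw [hP]; trivial
    exact this
  choose c hc using hex
  refine ⟨∑ j, ‖c j‖, fun k i j => ?_⟩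
  have h1 := (norm_le_pi_norm ((A ^ k) *ᵥ Pi.single j 1) i).trans (hc j k)
  rw [Matrix.mulVec_single_one] at h1
  exact (h1.trans (le_abs_self _)).trans
    (Finset.single_le_sum (f := fun j => ‖c j‖) (fun _ _ => norm_nonneg _) (Finset.mem_univ j))

theorem Matrix.exists_bound_mul {l m n : ℕ} {f : ℕ → Matrix (Fin l) (Fin m) ℝ}
    {g : ℕ → Matrix (Fin m) (Fin n) ℝ} (hf : ∃ c, ∀ k i j, |f k i j| ≤ c)
    (hg : ∃ c, ∀ k i j, |g k i j| ≤ c) : ∃ c, ∀ k i j, |(f k * g k) i j| ≤ c := by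
  obtain ⟨c, hc⟩ := hf
  obtain ⟨d, hd⟩ := hg
  refine ⟨∑ _x : Fin m, c * d, fun k i j => ?_⟩
  rw [Matrix.mul_apply]
  refine (Finset.abs_sum_le_sum_abs _ _).trans (Finset.sum_le_sum fun a _ => ?_)
  rw [abs_mul]
  exact mul_le_mul (hc k i a) (hd k a j) (abs_nonneg _) ((abs_nonneg _).trans (hc k i a))

theorem Matrix.exists_bound_const {m n : ℕ} (B : Matrix (Fin m) (Fin n) ℝ) :
    ∃ c, ∀ (_k : ℕ) i j, |B i j| ≤ c := by
  refine ⟨∑ i, ∑ j, |B i j|, fun _ i j => ?_⟩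
  refine (Finset.single_le_sum (f := fun j => |B i j|) (fun _ _ => abs_nonneg _)
    (Finset.mem_univ j)).trans ?_
  exact Finset.single_le_sum (f := fun i => ∑ j, |B i j|)
    (fun _ _ => Finset.sum_nonneg fun _ _ => abs_nonneg _) (Finset.mem_univ i)

instance Matrix.firstCountableTopology {m n : ℕ} :
    FirstCountableTopology (Matrix (Fin m) (Fin n) ℝ) :=
  inferInstanceAs (FirstCountableTopology (Fin m → Fin n → ℝ))

theorem Matrix.isCompact_setOf_abs_le (m n : ℕ) (c : ℝ) :
    IsCompact {B : Matrix (Fin m) (Fin n) ℝ | ∀ i j, |B i j| ≤ c} := by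
  have : IsCompact (Set.pi Set.univ fun _ : Fin m => Set.pi Set.univ fun _ : Fin n =>
      Set.Icc (-c) c) :=
    isCompact_univ_pi fun _ => isCompact_univ_pi fun _ => isCompact_Icc
  have hset : {B : Matrix (Fin m) (Fin n) ℝ | ∀ i j, |B i j| ≤ c} =
      (Set.pi Set.univ fun _ : Fin m => Set.pi Set.univ fun _ : Fin n => Set.Icc (-c) c) := by
    refine Set.ext fun B => ?_
    simp only [abs_le]
    exact ⟨fun h i _ j _ => h i j, fun h i j => h i trivial j trivial⟩
  rw [hset]
  exact this

/-- Bounded powers of a matrix accumulate at an idempotent. -/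
theorem Matrix.exists_idempotent_limit {n : ℕ} {A : Matrix (Fin n) (Fin n) ℝ}
    (hA : ∃ c, ∀ k i j, |(A ^ k) i j| ≤ c) :
    ∃ (E : Matrix (Fin n) (Fin n) ℝ) (φ : ℕ → ℕ), E * E = E ∧ StrictMono φ ∧
      Tendsto (fun k => A ^ φ k) atTop (𝓝 E) := by
  obtain ⟨c, hc⟩ := hA
  have hK := Matrix.isCompact_setOf_abs_le n n c
  let s : Set (Matrix (Fin n) (Fin n) ℝ) := {B | MapClusterPt B atTop fun k => A ^ k}
  have hsK : s ⊆ {B | ∀ i j, |B i j| ≤ c} := by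
    intro B hB
    obtain ⟨φ, -, hφ⟩ := MapClusterPt.tendsto_subseq hB
    exact hK.isClosed.mem_of_tendsto hφ (Eventually.of_forall fun k => hc (φ k))
  have hsc : IsCompact s := hK.of_isClosed_subset isClosed_setOfPred_clusterPt hsK
  have hsn : s.Nonempty := by
    obtain ⟨B, -, φ, hφ, hB⟩ := hK.tendsto_subseq (x := fun k => A ^ k) hc
    exact ⟨B, MapClusterPt.of_comp hφ.tendsto_atTop hB.mapClusterPt⟩
  -- The cluster points of the powers form a nonempty compact semigroup, since exponents add; the
  -- Ellis–Numakura lemma provides an idempotent in it.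
  obtain ⟨E, hE, hEE⟩ := exists_idempotent_in_compact_subsemigroup
    (fun r => continuous_id.mul continuous_const) s hsn hsc (by
      intro B hB B' hB'
      obtain ⟨φ, hφ, hφB⟩ := MapClusterPt.tendsto_subseq hB
      obtain ⟨ψ, hψ, hψB⟩ := MapClusterPt.tendsto_subseq hB'
      have hlim : Tendsto ((fun k => A ^ k) ∘ fun k => φ k + ψ k) atTop (𝓝 (B * B')) := by
        simpa [Function.comp_def, pow_add] using hφB.mul hψB
      exact MapClusterPt.of_comp
        (tendsto_atTop_mono (fun k => Nat.le_add_right _ _) hφ.tendsto_atTop) hlim.mapClusterPt)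
  obtain ⟨φ, hφ, hφE⟩ := MapClusterPt.tendsto_subseq hE
  exact ⟨E, φ, hEE, hφ, hφE⟩

/-! ### Invariant inner products -/

open scoped MatrixOrder in
theorem Matrix.PosDef.exists_isUnit_transpose_mul_self {n : ℕ} {G : Matrix (Fin n) (Fin n) ℝ}
    (hG : G.PosDef) : ∃ Y : Matrix (Fin n) (Fin n) ℝ, IsUnit Y ∧ Y.transpose * Y = G := by
  obtain ⟨Y, hY⟩ := CStarAlgebra.nonneg_iff_eq_star_mul_self.mp hG.posSemidef.nonneg
  rw [Matrix.star_eq_conjTranspose, Matrix.conjTranspose_eq_transpose_of_trivial] at hY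
  refine ⟨Y, ?_, hY.symm⟩
  have h := hG.isUnit
  rw [hY, Matrix.isUnit_iff_isUnit_det, Matrix.det_mul, Matrix.det_transpose] at h
  rw [Matrix.isUnit_iff_isUnit_det]
  exact isUnit_of_mul_isUnit_left h

theorem Matrix.exists_dotProduct_mulVec_le {n : ℕ} {f : ℕ → Matrix (Fin n) (Fin n) ℝ}
    (hf : ∃ c, ∀ k i j, |f k i j| ≤ c) :
    ∃ K, 0 ≤ K ∧ ∀ k x, (f k *ᵥ x) ⬝ᵥ (f k *ᵥ x) ≤ K * (x ⬝ᵥ x) := by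
  obtain ⟨c, hc⟩ := hf
  refine ⟨∑ _i : Fin n, ∑ _j : Fin n, c ^ 2,
    Finset.sum_nonneg fun _ _ => Finset.sum_nonneg fun _ _ => sq_nonneg c, fun k x => ?_⟩
  rw [Finset.sum_mul]
  refine Finset.sum_le_sum fun i _ => ?_
  have h1 := Finset.sum_mul_sq_le_sq_mul_sq Finset.univ (f k i) x
  have h2 : ∑ j, f k i j ^ 2 ≤ ∑ _j : Fin n, c ^ 2 :=
    Finset.sum_le_sum fun j _ => by
      rw [← sq_abs]
      exact pow_le_pow_left₀ (abs_nonneg _) (hc k i j) 2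
  have h3 : x ⬝ᵥ x = ∑ j, x j ^ 2 := by simp [dotProduct, sq]
  rw [h3, ← sq]
  exact h1.trans (mul_le_mul_of_nonneg_right h2 (Finset.sum_nonneg fun _ _ => sq_nonneg _))

/-- A matrix with bounded powers that return to the identity is similar to an orthogonal matrix. -/
theorem Matrix.exists_orthogonal_conj {n : ℕ} {M : Matrix (Fin n) (Fin n) ℝ}
    (hM : ∃ c, ∀ k i j, |(M ^ k) i j| ≤ c) {φ : ℕ → ℕ} (hφ : StrictMono φ)
    (hφM : Tendsto (fun k => M ^ φ k) atTop (𝓝 1)) :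
    ∃ Y : Matrix (Fin n) (Fin n) ℝ, IsUnit Y ∧ Y * M * Y⁻¹ ∈ Matrix.orthogonalGroup (Fin n) ℝ := by
  obtain ⟨K, hK0, hK⟩ := Matrix.exists_dotProduct_mulVec_le hM
  let F : ℕ → Matrix (Fin n) (Fin n) ℝ := fun j => (M ^ j).transpose * M ^ j
  obtain ⟨d, hd⟩ : ∃ c, ∀ k i j, |F k i j| ≤ c := by
    refine Matrix.exists_bound_mul (f := fun k => (M ^ k).transpose) ?_ hM
    obtain ⟨c, hc⟩ := hM
    exact ⟨c, fun k i j => hc k j i⟩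
  -- Cesàro means of the Gram matrices of the powers. The change under `B ↦ Mᵀ B M` telescopes to a
  -- bounded difference over `k + 1`, so any cluster point is invariant.
  let G : ℕ → Matrix (Fin n) (Fin n) ℝ := fun k =>
    ((k : ℝ) + 1)⁻¹ • ∑ j ∈ Finset.range (k + 1), F j
  have hpos : ∀ k : ℕ, 0 < ((k : ℝ) + 1)⁻¹ := fun k => by positivity
  have hGd : ∀ k i j, |G k i j| ≤ d := by
    intro k i j
    have h1 : |∑ l ∈ Finset.range (k + 1), F l i j| ≤ ((k : ℝ) + 1) * d := by
      refine (Finset.abs_sum_le_sum_abs _ _).trans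
        ((Finset.sum_le_sum fun l _ => hd l i j).trans_eq ?_)
      simp
    simp only [G, Matrix.smul_apply, Matrix.sum_apply, smul_eq_mul, abs_mul, abs_of_pos (hpos k)]
    rw [inv_mul_le_iff₀ (by positivity)]
    exact h1
  obtain ⟨H, -, ψ, hψ, hH⟩ := (Matrix.isCompact_setOf_abs_le n n d).tendsto_subseq hGd
  have hinv : M.transpose * H * M = H := by
    have hdiff : ∀ k, M.transpose * G k * M - G k = ((k : ℝ) + 1)⁻¹ • (F (k + 1) - F 0) := by
      intro k
      have h1 : ∀ j, M.transpose * F j * M = F (j + 1) := by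
        intro j
        simp only [F, pow_succ, Matrix.transpose_mul, Matrix.mul_assoc]
      simp only [G, Matrix.mul_smul, Matrix.smul_mul, Matrix.mul_sum, Matrix.sum_mul, h1]
      rw [← smul_sub, ← Finset.sum_sub_distrib, Finset.sum_range_sub]
    have hlim : Tendsto (fun k => M.transpose * G k * M - G k) atTop (𝓝 0) := by
      simp only [hdiff]
      refine tendsto_pi_nhds.2 fun i => tendsto_pi_nhds.2 fun j => ?_
      have h0 : Tendsto (fun k : ℕ => ((k : ℝ) + 1)⁻¹ * (d + d)) atTop (𝓝 0) := by
        have := (tendsto_one_div_add_atTop_nhds_zero_nat (𝕜 := ℝ)).mul_const (d + d)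
        simpa using this
      refine squeeze_zero_norm (fun k => ?_) h0
      simp only [Matrix.smul_apply, Matrix.sub_apply, smul_eq_mul, Real.norm_eq_abs, abs_mul,
        abs_of_pos (hpos k)]
      exact mul_le_mul_of_nonneg_left
        ((abs_sub _ _).trans (add_le_add (hd _ i j) (hd _ i j))) (hpos k).le
    have hlim' : Tendsto (fun k => M.transpose * G (ψ k) * M - G (ψ k)) atTop
        (𝓝 (M.transpose * H * M - H)) :=
      ((hH.const_mul _).mul_const _).sub hH
    exact sub_eq_zero.1 (tendsto_nhds_unique hlim' (hlim.comp hψ.tendsto_atTop))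
  -- Recurrence keeps orbits away from zero: `x` is the limit of `M ^ (φ i - j) (M ^ j x)`, and the
  -- first factor is uniformly bounded. This makes the averaged form definite.
  have hlow : ∀ x j, x ⬝ᵥ x ≤ K * ((M ^ j *ᵥ x) ⬝ᵥ (M ^ j *ᵥ x)) := by
    intro x j
    have hcont : Continuous fun B : Matrix (Fin n) (Fin n) ℝ => (B *ᵥ x) ⬝ᵥ (B *ᵥ x) := by fun_prop
    have ht := (hcont.tendsto 1).comp hφM
    simp only [Matrix.one_mulVec] at ht
    refine le_of_tendsto ht (eventually_atTop.2 ⟨j, fun i hi => ?_⟩)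
    have h1 : φ i = (φ i - j) + j := (Nat.sub_add_cancel (hi.trans (hφ.id_le i))).symm
    have h2 := hK (φ i - j) (M ^ j *ᵥ x)
    rw [Matrix.mulVec_mulVec, ← pow_add, ← h1] at h2
    exact h2
  have hHpos : H.PosDef := by
    refine Matrix.PosDef.of_dotProduct_mulVec_pos ?_ fun x hx => ?_
    · have h1 : ∀ k, (G k).transpose = G k := by
        intro k
        simp [G, F, Matrix.transpose_sum, Matrix.transpose_mul]
      have h2 : Tendsto (fun k => (G (ψ k)).transpose) atTop (𝓝 H.transpose) :=
        (continuous_id.matrix_transpose.tendsto H).comp hH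
      simp only [h1] at h2
      rw [Matrix.IsHermitian, Matrix.conjTranspose_eq_transpose_of_trivial]
      exact tendsto_nhds_unique h2 hH
    · have hcont : Continuous fun B : Matrix (Fin n) (Fin n) ℝ => K * (x ⬝ᵥ (B *ᵥ x)) := by
        fun_prop
      have h1 : x ⬝ᵥ x ≤ K * (x ⬝ᵥ (H *ᵥ x)) := by
        refine ge_of_tendsto' ((hcont.tendsto H).comp hH) fun k => ?_
        simp only [Function.comp_apply]
        generalize ψ k = k
        have h2 : ∀ j, x ⬝ᵥ (F j *ᵥ x) = (M ^ j *ᵥ x) ⬝ᵥ (M ^ j *ᵥ x) := by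
          intro j
          simp only [F]
          rw [← Matrix.mulVec_mulVec, Matrix.dotProduct_mulVec, Matrix.vecMul_transpose]
        simp only [G, Matrix.smul_mulVec, Matrix.sum_mulVec, dotProduct_smul, dotProduct_sum, h2,
          smul_eq_mul]
        rw [mul_left_comm, ← div_eq_inv_mul, le_div_iff₀ (by positivity), Finset.mul_sum]
        calc x ⬝ᵥ x * ((k : ℝ) + 1) = ∑ _j ∈ Finset.range (k + 1), x ⬝ᵥ x := by
              simp [mul_comm]
          _ ≤ _ := Finset.sum_le_sum fun j _ => hlow x j
      have h2 : 0 < x ⬝ᵥ x :=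
        lt_of_le_of_ne (Finset.sum_nonneg fun _ _ => mul_self_nonneg _)
          fun h => hx (dotProduct_self_eq_zero.1 h.symm)
      rw [star_trivial]
      exact pos_of_mul_pos_right (h2.trans_le h1) hK0
  obtain ⟨Y, hY, hYH⟩ := hHpos.exists_isUnit_transpose_mul_self
  refine ⟨Y, hY, (Matrix.mem_orthogonalGroup_iff' _ _).2 ?_⟩
  have hdet := (Matrix.isUnit_iff_isUnit_det _).1 hY
  calc (Y * M * Y⁻¹).transpose * (Y * M * Y⁻¹)
      = Y⁻¹.transpose * (M.transpose * (Y.transpose * Y) * M) * Y⁻¹ := by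
        simp only [Matrix.transpose_mul, Matrix.mul_assoc]
    _ = (Y * Y⁻¹).transpose * (Y * Y⁻¹) := by
        rw [hYH, hinv, ← hYH]
        simp only [Matrix.transpose_mul, Matrix.mul_assoc]
    _ = 1 := by rw [Matrix.mul_nonsing_inv _ hdet]; simp

/-! ### Splitting off the orthogonal part -/

/-- A basis adapted to the range and the kernel of an idempotent matrix. -/
theorem Matrix.exists_basis_of_idempotent {n : ℕ} {E : Matrix (Fin n) (Fin n) ℝ} (hE : E * E = E) :
    ∃ (n₁ n₂ : ℕ) (U : Matrix (Fin n) (Fin n₁) ℝ) (W : Matrix (Fin n) (Fin n₂) ℝ)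
      (T₁ : Matrix (Fin n₁) (Fin n) ℝ) (T₂ : Matrix (Fin n₂) (Fin n) ℝ),
      Matrix.fromRows T₁ T₂ * Matrix.fromCols U W = 1 ∧
      Matrix.fromCols U W * Matrix.fromRows T₁ T₂ = 1 ∧ E * U = U ∧ E * W = 0 := by
  let f := Matrix.toLin' E
  have hf : IsIdempotentElem f := by
    rw [IsIdempotentElem, Module.End.mul_eq_comp, ← Matrix.toLin'_mul, hE]
  have hc := LinearMap.IsIdempotentElem.isCompl hf
  let b₁ := Module.finBasis ℝ (LinearMap.range f)
  let b₂ := Module.finBasis ℝ (LinearMap.ker f)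
  let b := (b₁.prod b₂).map (Submodule.prodEquivOfIsCompl _ _ hc)
  let e := Pi.basisFun ℝ (Fin n)
  have hU : ∀ i k, e.toMatrix b i (Sum.inl k) = (b₁ k : Fin n → ℝ) i := by
    intro i k
    simp [e, b, Module.Basis.toMatrix_apply]
  have hW : ∀ i k, e.toMatrix b i (Sum.inr k) = (b₂ k : Fin n → ℝ) i := by
    intro i k
    simp [e, b, Module.Basis.toMatrix_apply]
  refine ⟨_, _, (e.toMatrix b).toCols₁, (e.toMatrix b).toCols₂, (b.toMatrix e).toRows₁,
    (b.toMatrix e).toRows₂, ?_, ?_, ?_, ?_⟩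
  · rw [Matrix.fromRows_toRows, Matrix.fromCols_toCols, Module.Basis.toMatrix_mul_toMatrix_flip]
  · rw [Matrix.fromRows_toRows, Matrix.fromCols_toCols, Module.Basis.toMatrix_mul_toMatrix_flip]
  · ext i k
    have h1 := congrFun ((LinearMap.IsIdempotentElem.mem_range_iff hf).1 (b₁ k).2) i
    simpa [Matrix.mul_apply, hU, f, Matrix.mulVec, dotProduct] using h1
  · ext i k
    have h1 : (E *ᵥ (b₂ k : Fin n → ℝ)) i = 0 := congrFun (LinearMap.mem_ker.1 (b₂ k).2) i
    simpa only [Matrix.mul_apply, Matrix.toCols₂_apply, hW, Matrix.zero_apply, Matrix.mulVec, dotProduct] using h1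

/-- A matrix whose powers accumulate at zero is Schur stable. -/
theorem schurStable_of_tendsto_pow {n : ℕ} {X : Matrix (Fin n) (Fin n) ℝ} {φ : ℕ → ℕ}
    (h : Tendsto (fun k => X ^ φ k) atTop (𝓝 0)) : SchurStable (toComplex X) := by
  rw [schurStable_iff]
  intro μ w hw hμ
  by_contra! hge
  have hpow : ∀ k, toComplex (X ^ k) *ᵥ w = μ ^ k • w := by
    intro k
    induction k with
    | zero => simp
    | succ k ih =>
      rw [pow_succ, toComplex_mul, ← Matrix.mulVec_mulVec, hμ, Matrix.mulVec_smul, ih, smul_smul,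
        pow_succ']
  have hcont : Continuous fun B : Matrix (Fin n) (Fin n) ℝ => ‖toComplex B *ᵥ w‖ := by
    have : Continuous fun B : Matrix (Fin n) (Fin n) ℝ => toComplex B :=
      continuous_id.matrix_map Complex.continuous_ofReal
    fun_prop
  have ht := (hcont.tendsto 0).comp h
  simp only [toComplex_zero, Matrix.zero_mulVec, norm_zero, Function.comp_def, hpow, norm_smul,
    norm_pow] at ht
  have := ge_of_tendsto' ht fun k => le_mul_of_one_le_left (norm_nonneg w) (one_le_pow₀ hge)
  exact hw (norm_le_zero_iff.1 this)

/-- A neutrally stable real matrix is similar to the direct sum of an orthogonal matrix and a Schur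
stable matrix. -/
theorem NeutrallyStable.exists_splitting {n : ℕ} {A : Matrix (Fin n) (Fin n) ℝ}
    (hA : NeutrallyStable (toComplex A)) :
    ∃ (n₁ n₂ : ℕ) (U : Matrix (Fin n) (Fin n₁) ℝ) (W : Matrix (Fin n) (Fin n₂) ℝ)
      (T : Matrix (Fin n₁ ⊕ Fin n₂) (Fin n) ℝ)
      (M : Matrix (Fin n₁) (Fin n₁) ℝ) (X : Matrix (Fin n₂) (Fin n₂) ℝ),
      T * Matrix.fromCols U W = 1 ∧ Matrix.fromCols U W * T = 1 ∧
      T * A * Matrix.fromCols U W = Matrix.fromBlocks M 0 0 X ∧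
      M ∈ Matrix.orthogonalGroup (Fin n₁) ℝ ∧ SchurStable (toComplex X) := by
  have hbound : ∃ c, ∀ k i j, |(A ^ k) i j| ≤ c := by
    obtain ⟨c, hc⟩ := hA.exists_pow_bound
    refine ⟨c, fun k i j => ?_⟩
    have h1 : toComplex A ^ k = toComplex (A ^ k) := (Matrix.map_pow A Complex.ofRealHom k).symm
    have h2 := hc k i j
    rw [h1] at h2
    simpa [toComplex] using h2
  obtain ⟨E, φ, hE, hφ, hAE⟩ := Matrix.exists_idempotent_limit hbound
  have hcomm : A * E = E * A := by
    refine tendsto_nhds_unique (hAE.const_mul A) ?_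
    simpa [← pow_succ, ← pow_succ'] using hAE.mul_const A
  obtain ⟨n₁, n₂, U, W, T₁, T₂, h1, h2, hEU, hEW⟩ := Matrix.exists_basis_of_idempotent hE
  rw [Matrix.fromRows_mul_fromCols, ← Matrix.fromBlocks_one, Matrix.fromBlocks_inj] at h1
  obtain ⟨hTU, hTW, hTU', hTW'⟩ := h1
  rw [Matrix.fromCols_mul_fromRows] at h2
  have hEdec : ∀ {k : ℕ} (B : Matrix (Fin n) (Fin k) ℝ), E * B = U * (T₁ * B) := by
    intro k B
    calc E * B = E * ((U * T₁ + W * T₂) * B) := by rw [h2, Matrix.one_mul]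
      _ = U * (T₁ * B) := by
        rw [← Matrix.mul_assoc, Matrix.mul_add, ← Matrix.mul_assoc, ← Matrix.mul_assoc, hEU, hEW,
          Matrix.zero_mul, add_zero, Matrix.mul_assoc]
  have hAU : A * U = U * (T₁ * (A * U)) := by
    rw [← hEdec, ← Matrix.mul_assoc, ← hcomm, Matrix.mul_assoc, hEU]
  have hAW : A * W = W * (T₂ * (A * W)) := by
    have h3 : U * (T₁ * (A * W)) = 0 := by
      rw [← hEdec, ← Matrix.mul_assoc, ← hcomm, Matrix.mul_assoc, hEW, Matrix.mul_zero]
    have h4 : (U * T₁ + W * T₂) * (A * W) = A * W := by rw [h2, Matrix.one_mul]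
    rw [Matrix.add_mul, Matrix.mul_assoc, h3, zero_add, Matrix.mul_assoc] at h4
    exact h4.symm
  set M₀ := T₁ * (A * U) with hM₀
  set X := T₂ * (A * W) with hX
  have hpowU : ∀ k, A ^ k * U = U * M₀ ^ k := by
    intro k
    induction k with
    | zero => simp
    | succ k ih => rw [pow_succ', Matrix.mul_assoc, ih, ← Matrix.mul_assoc, hAU, Matrix.mul_assoc,
        pow_succ']
  have hpowW : ∀ k, A ^ k * W = W * X ^ k := by
    intro k
    induction k with
    | zero => simp
    | succ k ih => rw [pow_succ', Matrix.mul_assoc, ih, ← Matrix.mul_assoc, hAW, Matrix.mul_assoc,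
        pow_succ']
  have hM₀pow : ∀ k, M₀ ^ k = T₁ * (A ^ k * U) := by
    intro k
    rw [hpowU, ← Matrix.mul_assoc, hTU, Matrix.one_mul]
  have hXpow : ∀ k, X ^ k = T₂ * (A ^ k * W) := by
    intro k
    rw [hpowW, ← Matrix.mul_assoc, hTW', Matrix.one_mul]
  have hM₀bound : ∃ c, ∀ k i j, |(M₀ ^ k) i j| ≤ c := by
    simp only [hM₀pow]
    exact Matrix.exists_bound_mul (Matrix.exists_bound_const T₁)
      (Matrix.exists_bound_mul hbound (Matrix.exists_bound_const U))
  -- Along `φ` the powers tend to `E`, which is the identity on range `U` and zero on range `W`.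
  have hM₀lim : Tendsto (fun k => M₀ ^ φ k) atTop (𝓝 1) := by
    have hcont : Continuous fun B : Matrix (Fin n) (Fin n) ℝ => T₁ * (B * U) := by fun_prop
    have := (hcont.tendsto E).comp hAE
    simpa only [Function.comp_def, ← hM₀pow, hEU, hTU] using this
  have hXlim : Tendsto (fun k => X ^ φ k) atTop (𝓝 0) := by
    have hcont : Continuous fun B : Matrix (Fin n) (Fin n) ℝ => T₂ * (B * W) := by fun_prop
    have := (hcont.tendsto E).comp hAE
    simpa only [Function.comp_def, ← hXpow, hEW, Matrix.mul_zero] using this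
  obtain ⟨Y, hY, hYM⟩ := Matrix.exists_orthogonal_conj hM₀bound hφ hM₀lim
  have hdet := (Matrix.isUnit_iff_isUnit_det _).1 hY
  have hYY := Matrix.mul_nonsing_inv Y hdet
  have hYY' := Matrix.nonsing_inv_mul Y hdet
  have hinv : Matrix.fromRows (Y * T₁) T₂ * Matrix.fromCols (U * Y⁻¹) W = 1 := by
    rw [Matrix.fromRows_mul_fromCols, ← Matrix.fromBlocks_one, Matrix.fromBlocks_inj]
    refine ⟨?_, ?_, ?_, hTW'⟩
    · rw [Matrix.mul_assoc, ← Matrix.mul_assoc T₁, hTU, Matrix.one_mul, hYY]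
    · rw [Matrix.mul_assoc, hTW, Matrix.mul_zero]
    · rw [← Matrix.mul_assoc, hTU', Matrix.zero_mul]
  refine ⟨n₁, n₂, U * Y⁻¹, W, Matrix.fromRows (Y * T₁) T₂, Y * M₀ * Y⁻¹, X, hinv, ?_, ?_, hYM,
    schurStable_of_tendsto_pow hXlim⟩
  · rw [Matrix.fromCols_mul_fromRows, Matrix.mul_assoc, ← Matrix.mul_assoc Y⁻¹, hYY',
      Matrix.one_mul, h2]
  · have h3 : A * Matrix.fromCols (U * Y⁻¹) W =
        Matrix.fromCols (U * Y⁻¹) W * Matrix.fromBlocks (Y * M₀ * Y⁻¹) 0 0 X := by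
      rw [Matrix.mul_fromCols, Matrix.fromCols_mul_fromBlocks, Matrix.mul_zero, Matrix.mul_zero,
        add_zero, zero_add, ← hAW, ← Matrix.mul_assoc, hAU]
      congr 1
      rw [Matrix.mul_assoc U Y⁻¹, ← Matrix.mul_assoc Y⁻¹, ← Matrix.mul_assoc Y⁻¹, hYY',
        Matrix.one_mul, Matrix.mul_assoc]
    rw [Matrix.mul_assoc, h3, ← Matrix.mul_assoc, hinv, Matrix.one_mul]

/-! ### Feasibility of the construction -/

/-- A subspace is the range of the transpose of a matrix with orthonormal rows. -/
theorem Submodule.exists_orthonormal_rows {n : ℕ} (R : Submodule ℝ (Fin n → ℝ)) :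
    ∃ (m : ℕ) (V : Matrix (Fin m) (Fin n) ℝ), V * V.transpose = 1 ∧
      LinearMap.range V.transpose.mulVecLin = R := by
  let b := Module.finBasis ℝ R
  let Q : Matrix (Fin n) (Fin (Module.finrank ℝ R)) ℝ := Matrix.of fun i k => (b k : Fin n → ℝ) i
  have hQ : ∀ x, Q *ᵥ x = ((b.equivFun.symm x : R) : Fin n → ℝ) := by
    intro x
    ext i
    simp [Q, Matrix.mulVec, dotProduct, Module.Basis.equivFun_symm_apply, mul_comm]
  have hQR : LinearMap.range Q.mulVecLin = R := by
    ext y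
    constructor
    · rintro ⟨x, rfl⟩
      rw [Matrix.mulVecLin_apply, hQ]
      exact Subtype.prop _
    · intro hy
      exact ⟨b.equivFun ⟨y, hy⟩, by rw [Matrix.mulVecLin_apply, hQ, LinearEquiv.symm_apply_apply]⟩
  have hQinj : Function.Injective Q.mulVec := by
    intro x y hxy
    rw [hQ, hQ] at hxy
    exact b.equivFun.symm.injective (Subtype.ext hxy)
  -- Factoring the Gram matrix of a basis as `Yᵀ Y` makes the columns of `Q Y⁻¹` orthonormal without
  -- changing their span.
  obtain ⟨Y, hY, hYQ⟩ :=
    (Matrix.PosDef.conjTranspose_mul_self Q hQinj).exists_isUnit_transpose_mul_self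
  rw [Matrix.conjTranspose_eq_transpose_of_trivial] at hYQ
  have hdet := (Matrix.isUnit_iff_isUnit_det _).1 hY
  have hYY := Matrix.mul_nonsing_inv Y hdet
  refine ⟨_, (Q * Y⁻¹).transpose, ?_, ?_⟩
  · calc (Q * Y⁻¹).transpose * (Q * Y⁻¹).transpose.transpose
        = Y⁻¹.transpose * (Q.transpose * Q) * Y⁻¹ := by
          simp only [Matrix.transpose_mul, Matrix.transpose_transpose, Matrix.mul_assoc]
      _ = (Y * Y⁻¹).transpose * (Y * Y⁻¹) := by
          rw [← hYQ]
          simp only [Matrix.transpose_mul, Matrix.mul_assoc]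
      _ = 1 := by rw [hYY]; simp
  · rw [Matrix.transpose_transpose]
    refine Eq.trans ?_ hQR
    ext y
    constructor
    · rintro ⟨x, rfl⟩
      exact ⟨Y⁻¹ *ᵥ x, by simp⟩
    · rintro ⟨x, rfl⟩
      refine ⟨Y *ᵥ x, ?_⟩
      rw [Matrix.mulVecLin_apply, Matrix.mulVecLin_apply, Matrix.mulVec_mulVec, Matrix.mul_assoc,
        Matrix.nonsing_inv_mul Y hdet, Matrix.mul_one]

theorem Matrix.exists_left_inverse_of_mulVec_eq_zero {m n : ℕ} {B : Matrix (Fin m) (Fin n) ℝ}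
    (h : ∀ x, B *ᵥ x = 0 → x = 0) : ∃ S : Matrix (Fin n) (Fin m) ℝ, S * B = 1 := by
  obtain ⟨g, hg⟩ := LinearMap.exists_leftInverse_of_injective (Matrix.toLin' B)
    (LinearMap.ker_eq_bot'.2 fun x hx => h x (by simpa using hx))
  refine ⟨LinearMap.toMatrix' g, ?_⟩
  have h1 := congrArg LinearMap.toMatrix' hg
  rwa [LinearMap.toMatrix'_comp, LinearMap.toMatrix'_toLin', LinearMap.toMatrix'_id] at h1

/-- The construction of the gain can be carried out for every neutrally stable matrix. -/
theorem NeutrallyStable.exists_isAlgorithmGain {n q : ℕ} {A : Matrix (Fin n) (Fin n) ℝ}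
    (C : Matrix (Fin q) (Fin n) ℝ) (hA : NeutrallyStable (toComplex A)) :
    ∃ L, IsAlgorithmGain A C L := by
  obtain ⟨n₁, n₂, U, W, T, M, X, h1, h2, h3, hM, hX⟩ := hA.exists_splitting
  obtain ⟨m, V, hV, hrange⟩ :=
    (LinearMap.range (U.transpose * C.transpose).mulVecLin).exists_orthonormal_rows
  obtain ⟨S, hS⟩ : ∃ S : Matrix (Fin m) (Fin q) ℝ, S * (C * U * V.transpose) = 1 := by
    refine Matrix.exists_left_inverse_of_mulVec_eq_zero fun y hy => ?_
    have hmem : V.transpose *ᵥ y ∈ LinearMap.range (U.transpose * C.transpose).mulVecLin := by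
      rw [← hrange]
      exact ⟨y, rfl⟩
    obtain ⟨x, hx⟩ := hmem
    rw [Matrix.mulVecLin_apply] at hx
    -- With `Vᵀ y = (CU)ᵀ x`, the squared norm equals `x ⬝ᵥ (C U Vᵀ y)`, which is zero.
    have h0 : (V.transpose *ᵥ y) ⬝ᵥ (V.transpose *ᵥ y) = 0 := by
      conv_lhs => lhs; rw [← hx]
      rw [← Matrix.transpose_mul, Matrix.mulVec_transpose, ← Matrix.dotProduct_mulVec,
        Matrix.mulVec_mulVec, hy, dotProduct_zero]
    have h4 := dotProduct_self_eq_zero.1 h0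
    rw [← Matrix.one_mulVec y, ← hV, ← Matrix.mulVec_mulVec, h4, Matrix.mulVec_zero]
  exact ⟨_, n₁, n₂, m, U, W, T, M, X, V, S, h1, h2, h3, hM, hX, hV, hrange, hS, rfl⟩

/-! ### The main theorem -/

theorem corollary2 {n q : ℕ} (A : Matrix (Fin n) (Fin n) ℝ) (C : Matrix (Fin q) (Fin n) ℝ)
    (hA : NeutrallyStable (toComplex A)) :
    -- some gain has the open unit disk in its consensus region iff `(A, C)` is detectable
    ((∃ L : Matrix (Fin n) (Fin q) ℝ, Metric.ball (0 : ℂ) 1 ⊆ consensusRegion A C L) ↔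
      Detectable A C) ∧
    -- unless `A` itself is Schur stable, the region can be taken to be exactly the open unit disk
    (¬ SchurStable (toComplex A) →
      ((∃ L : Matrix (Fin n) (Fin q) ℝ, consensusRegion A C L = Metric.ball (0 : ℂ) 1) ↔
        Detectable A C)) ∧
    -- for each number of agents: some gain gives consensus for all spanning-tree topologies
    -- iff `(A, C)` is detectable
    (∀ N : ℕ, 2 ≤ N →
      ((∃ L : Matrix (Fin n) (Fin q) ℝ, ReachesConsensusForAllTopologies A C L N) ↔
        Detectable A C)) ∧
    -- the two properties of a gain are equivalent
    (∀ L : Matrix (Fin n) (Fin q) ℝ,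
      Metric.ball (0 : ℂ) 1 ⊆ consensusRegion A C L ↔
        ∀ N : ℕ, ReachesConsensusForAllTopologies A C L N) ∧
    -- if `(A, C)` is detectable, the algorithm can be carried out, and each gain it yields works
    (Detectable A C →
      (∃ L : Matrix (Fin n) (Fin q) ℝ, IsAlgorithmGain A C L) ∧
      ∀ L : Matrix (Fin n) (Fin q) ℝ, IsAlgorithmGain A C L →
        Metric.ball (0 : ℂ) 1 ⊆ consensusRegion A C L ∧
        (¬ SchurStable (toComplex A) → consensusRegion A C L = Metric.ball (0 : ℂ) 1) ∧
        ∀ N : ℕ, ReachesConsensusForAllTopologies A C L N) := by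
  obtain ⟨L₀, hL₀⟩ := hA.exists_isAlgorithmGain C
  have hzero : (0 : ℂ) ∈ Metric.ball (0 : ℂ) 1 := Metric.mem_ball_self one_pos
  refine ⟨⟨?_, ?_⟩, fun hAs => ⟨?_, ?_⟩, fun N hN => ⟨?_, ?_⟩, fun L => ⟨?_, ?_⟩,
    fun hd => ⟨⟨L₀, hL₀⟩, fun L hL => ⟨hL.ball_subset hd, hL.consensusRegion_eq hd,
      fun N => reachesConsensus_of_ball_subset (hL.ball_subset hd)⟩⟩⟩
  · rintro ⟨L, hL⟩
    exact detectable_of_zero_mem (hL hzero)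
  · exact fun hd => ⟨L₀, hL₀.ball_subset hd⟩
  · rintro ⟨L, hL⟩
    exact detectable_of_zero_mem (hL.symm ▸ hzero)
  · exact fun hd => ⟨L₀, hL₀.consensusRegion_eq hd hAs⟩
  · rintro ⟨L, hL⟩
    exact hL.detectable hN
  · exact fun hd => ⟨L₀, reachesConsensus_of_ball_subset (hL₀.ball_subset hd)⟩
  · exact fun h N => reachesConsensus_of_ball_subset h
  · exact ball_subset_of_reachesConsensus
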